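/- \textbf{Model.} A CONGEST network is a connected graph on $n$ vertices with distinct identifiers $0,\dots,n-1$. A vertex initially knows $n$, its own identifier, the identifiers of its neighbours, and its local part of the input. In each synchronous round every vertex may send each neighbour a (possibly different) message of $O(\log n)$ bits; local computation is unrestricted. All weights are integers in $\{0,\dots,n\}$. A randomized algorithm (with private or shared coins; deterministic algorithms included) is a \emph{$\rho$-approximation in $t$ rounds} for a minimization problem on $n$-vertex networks if on every such instance, with probability at least $2/3$, the local outputs after $t$ rounds form a feasible solution of cost at most $\rho$ times the optimum. ``A $\rho(n)$-approximation requires $\Omega(f(n))$ rounds'' means: for every constant $b$, if messages have at most $b\lceil\log_2 n\rceil$ bits, there are $c>0$ and $N$ such that for all $n\ge N$ every $\rho(n)$-approximation in $t$ rounds has $t\ge c\,f(n)$. Finally, $\widetilde\Omega(n)$ means $\Omega(n/\log^p n)$ for some constant $p$. \textbf{Problems.} \begin{itemize} \item \emph{Weighted $k$-MDS}: given a vertex-weighted graph, find a set $S$ of vertices of minimum total weight such that every vertex is at distance at most $k$ from $S$. Each vertex outputs whether it is in $S$. \item \emph{Node weighted Steiner tree}: given a vertex-weighted graph and a nonempty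 set of terminals (each vertex knows whether it is a terminal), find a subtree that contains all terminals and has minimum total vertex weight. Each vertex outputs which of its incident edges are selected; the solution consists of the edges selected by at least one endpoint, their endpoints, and the terminals. \item \emph{Directed Steiner tree}: given a loopless directed graph with arc weights, a root and a set of terminals reachable from the root, find a directed tree with this root that contains all terminals and has minimum total arc weight. The communication network is the underlying undirected graph, assumed connected; each vertex knows its incident arcs with their directions and weights, and whether it is the root or a terminal. Each vertex outputs which of its incident arcs are selected; the solution consists of the arcs selected by at least one endpoint. \end{itemize} \textbf{Theorem.} Let $\mathcal P$ be weighted $k$-MDS for a constant $k\ge 2$ (in particular weighted $2$-MDS), or the node weighted Steiner tree problem, or the directed Steiner tree problem. Then: \begin{enumerate} \item there is a constant $\beta>0$ such that for every constant $0<\varepsilon<1$, obtaining a $(\beta\varepsilon\log n)$-approximation for $\mathcal P$ requires $\Omega(n^{1-\varepsilon}/\log n)$ rounds in the CONGEST model (the hidden constants may depend on $\varepsilon$); \item there is a constant $\beta>0$ such that obtaining a $(\beta\log\log n)$-approximation for $\mathcal P$ requires $\widetilde\Omega(n)$ rounds in the CONGEST model. \end{enumerate} For $k$-MDS the constants $\beta$,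 $p$ and the hidden constants may depend on $k$. -/

import Mathlib

open MeasureTheory

namespace Congest

/-- A deterministic CONGEST algorithm for networks with vertex identifiers `0, …, n-1`, in which a
vertex starts with a local input of type `Loc`, ends with an output of type `Out`, and sends, in
every round, a message of at most `B` bits to each neighbour. Local memory and local computation
are unrestricted. Different neighbours may receive different messages. -/
structure Algorithm (n : ℕ) (Loc Out : Type) (B : ℕ) where
  /-- the states of a vertex -/
  State : Type
  /-- the initial state, from the identifier and the local input -/
  init : Fin n → Loc → State
  /-- the message sent to the neighbour with the given identifier -/
  send : State → Fin n → List Bool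
  /-- the bandwidth restriction -/
  length_send_le : ∀ s u, (send s u).length ≤ B
  /-- the new state, from the old one and the messages received (indexed by the senders) -/
  update : State → (Fin n → List Bool) → State
  /-- the output read off from a state -/
  output : State → Out

open Classical in
/-- The state of each vertex after `t` synchronous rounds on the network `G` with local inputs `x`.
Messages travel only along edges of `G`; the entries of non-neighbours are empty. -/
noncomputable def Algorithm.state {n : ℕ} {Loc Out : Type} {B : ℕ} (A : Algorithm n Loc Out B)
    (G : SimpleGraph (Fin n)) (x : Fin n → Loc) : ℕ → Fin n → A.State
  | 0, v => A.init v (x v)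
  | t + 1, v => A.update (A.state G x t v)
      (fun u => if G.Adj u v then A.send (A.state G x t u) v else [])

/-- The outputs of the vertices after `t` rounds. -/
noncomputable def Algorithm.run {n : ℕ} {Loc Out : Type} {B : ℕ} (A : Algorithm n Loc Out B)
    (G : SimpleGraph (Fin n)) (x : Fin n → Loc) (t : ℕ) : Fin n → Out :=
  fun v => A.output (A.state G x t v)

/-- A distributed minimization problem on networks with `n` vertices. -/
structure MinProblem (n : ℕ) where
  /-- the instances -/
  Inst : Type
  /-- the communication network of an instance -/
  network : Inst → SimpleGraph (Fin n)
  /-- the local inputs of vertices -/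
  Loc : Type
  /-- what a vertex knows initially about the instance -/
  view : Inst → Fin n → Loc
  /-- the local outputs of vertices -/
  Out : Type
  /-- the local outputs together describe a feasible solution -/
  Feasible : Inst → (Fin n → Out) → Prop
  /-- the cost of the solution that is described by the local outputs -/
  cost : Inst → (Fin n → Out) → ℕ

/-- The local outputs `o` describe a feasible solution whose cost is at most `ρ` times the cost of
every feasible solution, that is, a `ρ`-approximate solution. -/
def MinProblem.IsApprox {n : ℕ} (P : MinProblem n) (I : P.Inst) (ρ : ℝ) (o : Fin n → P.Out) :
    Prop :=
  P.Feasible I o ∧ ∀ o', P.Feasible I o' → (P.cost I o : ℝ) ≤ ρ * (P.cost I o' : ℝ)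

/-- A randomized algorithm with coin tosses `ω` distributed according to `μ`, given as the family of
the deterministic algorithms `A ω`, is a `ρ`-approximation in `t` rounds: on every instance the
outputs after `t` rounds are `ρ`-approximate with probability at least `2/3`. The coin tosses may be
shared by all vertices; private coin tosses are the case in which `Ω` is a product over the vertices
and each vertex uses only its own coordinate, and deterministic algorithms are the case of a
one-point `Ω`. -/
def MinProblem.IsApproxAlgorithm {n : ℕ} (P : MinProblem n) {B : ℕ} {Ω : Type} [MeasurableSpace Ω]
    (μ : Measure Ω) (A : Ω → Algorithm n P.Loc P.Out B) (ρ : ℝ) (t : ℕ) : Prop :=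
  ∀ I : P.Inst,
    MeasurableSet {ω | P.IsApprox I ρ ((A ω).run (P.network I) (P.view I) t)} ∧
    2 / 3 ≤ μ {ω | P.IsApprox I ρ ((A ω).run (P.network I) (P.view I) t)}

/-- Every randomized (in particular, every deterministic) `ρ(n)`-approximation algorithm for `P` in
the CONGEST model takes `Ω(f(n))` rounds. The bandwidth is `O(log n)`, that is, `b * ⌈log₂ n⌉` bits
for an arbitrary constant `b`, on which only the hidden constants of the bound may depend. -/
def RequiresRounds (P : ∀ n : ℕ, MinProblem n) (ρ f : ℕ → ℝ) : Prop :=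
  ∀ b : ℕ, ∃ c : ℝ, 0 < c ∧ ∃ N : ℕ, ∀ n : ℕ, N ≤ n →
    ∀ (Ω : Type) [MeasurableSpace Ω] (μ : Measure Ω) [IsProbabilityMeasure μ]
      (A : Ω → Algorithm n (P n).Loc (P n).Out (b * Nat.clog 2 n)) (t : ℕ),
      (P n).IsApproxAlgorithm μ A (ρ n) t → c * f n ≤ (t : ℝ)

/-- The total weight of a set. -/
noncomputable def weight {α : Type} [Fintype α] (w : α → ℕ) (s : Set α) : ℕ :=
  ∑ a, s.indicator w a

/-! ### Weighted `k`-dominating set -/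

/-- A connected graph with vertex weights in `{0, …, n}`. -/
structure WeightedGraph (n : ℕ) where
  graph : SimpleGraph (Fin n)
  connected : graph.Connected
  w : Fin n → ℕ
  w_le : ∀ v, w v ≤ n

/-- The initial knowledge of a vertex: its weight and the identifiers of its neighbours. -/
structure VertexView (n : ℕ) where
  weight : ℕ
  nbrs : Set (Fin n)

/-- `D` is a `k`-dominating set: every vertex is at distance at most `k` from `D`. -/
def IsKDominating {V : Type} (G : SimpleGraph V) (k : ℕ) (D : Set V) : Prop :=
  ∀ v, ∃ s ∈ D, G.edist v s ≤ (k : ℕ∞)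

/-- The minimum weight `k`-dominating set problem; each vertex outputs whether it is chosen. -/
noncomputable def kMDS (k n : ℕ) : MinProblem n where
  Inst := WeightedGraph n
  network := fun I => I.graph
  Loc := VertexView n
  view := fun I v => ⟨I.w v, I.graph.neighborSet v⟩
  Out := Bool
  Feasible := fun I o => IsKDominating I.graph k {v | o v = true}
  cost := fun I o => weight I.w {v | o v = true}

/-! ### Node weighted Steiner tree -/

/-- A connected graph with vertex weights in `{0, …, n}` and a nonempty set of terminals. -/
structure SteinerInstance (n : ℕ) extends WeightedGraph n where
  terminals : Set (Fin n)
  terminals_nonempty : terminals.Nonempty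

/-- The initial knowledge of a vertex: its weight, the identifiers of its neighbours, and whether
it is a terminal. -/
structure SteinerView (n : ℕ) extends VertexView n where
  isTerminal : Prop

/-- Each vertex outputs a set of neighbours. The edges selected are those that at least one of their
two endpoints selects; the solution consists of the selected edges, their endpoints, and the
terminals. -/
def SteinerInstance.selected {n : ℕ} (I : SteinerInstance n) (o : Fin n → Set (Fin n)) :
    I.graph.Subgraph where
  verts := {v | v ∈ I.terminals ∨ ∃ u, I.graph.Adj v u ∧ (u ∈ o v ∨ v ∈ o u)}
  Adj := fun u v => I.graph.Adj u v ∧ (v ∈ o u ∨ u ∈ o v)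
  adj_sub := fun h => h.1
  edge_vert := fun h => Or.inr ⟨_, h⟩
  symm := ⟨fun _ _ h => ⟨h.1.symm, h.2.symm⟩⟩

/-- The node weighted Steiner tree problem: find a tree that contains all terminals and has minimum
total vertex weight. -/
noncomputable def nodeSteiner (n : ℕ) : MinProblem n where
  Inst := SteinerInstance n
  network := fun I => I.graph
  Loc := SteinerView n
  view := fun I v => ⟨⟨I.w v, I.graph.neighborSet v⟩, v ∈ I.terminals⟩
  Out := Set (Fin n)
  Feasible := fun I o => (I.selected o).coe.IsTree ∧ I.terminals ⊆ (I.selected o).verts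
  cost := fun I o => weight I.w (I.selected o).verts

/-! ### Directed Steiner tree -/

/-- A directed graph without loops, with arc weights in `{0, …, n}`, a root and a set of terminals
that are reachable from the root. The underlying undirected graph is connected. -/
structure DirectedSteinerInstance (n : ℕ) where
  digraph : Digraph (Fin n)
  loopless : ∀ v, ¬ digraph.Adj v v
  connected : digraph.toSimpleGraphInclusive.Connected
  w : Fin n × Fin n → ℕ
  w_le : ∀ e, w e ≤ n
  root : Fin n
  terminals : Set (Fin n)
  reachable : ∀ s ∈ terminals, Relation.ReflTransGen digraph.Adj root s

/-- The initial knowledge of a vertex: for each identifier `u`, the weight of the arc to `u` and of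
the arc from `u` (`none` if there is no such arc), and whether it is the root or a terminal. -/
structure DirectedSteinerView (n : ℕ) where
  outArc : Fin n → Option ℕ
  inArc : Fin n → Option ℕ
  isRoot : Prop
  isTerminal : Prop

/-- Each vertex outputs a set of arcs. The arcs selected are those that at least one of their two
endpoints selects. -/
def DirectedSteinerInstance.selected {n : ℕ} (I : DirectedSteinerInstance n)
    (o : Fin n → Set (Fin n × Fin n)) : Set (Fin n × Fin n) :=
  {e | I.digraph.Adj e.1 e.2 ∧ (e ∈ o e.1 ∨ e ∈ o e.2)}

/-- `F` is the arc set of a directed tree with root `r`, all arcs pointing away from the root: no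
arc enters `r`, at most one arc enters any vertex, and every arc can be reached from `r`. -/
def IsDirectedTree {V : Type} (F : Set (V × V)) (r : V) : Prop :=
  (∀ u, (u, r) ∉ F) ∧
  (∀ u u' v, (u, v) ∈ F → (u', v) ∈ F → u = u') ∧
  ∀ u v, (u, v) ∈ F → Relation.ReflTransGen (fun a b => (a, b) ∈ F) r u

open Classical in
/-- The directed Steiner tree problem: find a directed tree with the given root that contains all
terminals and has minimum total arc weight. -/
noncomputable def directedSteiner (n : ℕ) : MinProblem n where
  Inst := DirectedSteinerInstance n
  network := fun I => I.digraph.toSimpleGraphInclusive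
  Loc := DirectedSteinerView n
  view := fun I v =>
    { outArc := fun u => if I.digraph.Adj v u then some (I.w (v, u)) else none
      inArc := fun u => if I.digraph.Adj u v then some (I.w (u, v)) else none
      isRoot := v = I.root
      isTerminal := v ∈ I.terminals }
  Out := Set (Fin n × Fin n)
  Feasible := fun I o => IsDirectedTree (I.selected o) I.root ∧
    ∀ s ∈ I.terminals, Relation.ReflTransGen (fun a b => (a, b) ∈ I.selected o) I.root s
  cost := fun I o => weight I.w (I.selected o)

end Congest

/-! Set disjointness on `T` elements is embedded in a fixed network that two players share, with
only `ℓ + 1` edges between them. Column `i` of a 0/1 matrix `M` is a set `S i` of rows. One player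
holds vertices for the sets, the other for their complements; such a vertex costs 1 if its index
lies in its owner's input and `n` otherwise. In all three problems a cheap solution must cover all
rows. A common index `i` gives the cover by `S i` and its complement, of cost 2. If the inputs `x`,
`y` are disjoint and every pattern on at most `r` columns occurs in some row, then a row with
pattern `y` on the chosen indices avoids all chosen cheap sets, so the cost exceeds `r`. By the
probabilistic method, slightly more than `2 ^ r * r * log (2 * T)` rows suffice
(`exists_universal_matrix`).

Hence an algorithm whose ratio is below `(r + 1) / 2` decides disjointness. After its coins are
fixed by averaging, the messages across the cut and the truncated costs of the two sides partition
the pairs of inputs into rectangles (`Algorithm.state_mixed`,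
`GapReduction.isRectangular_protocol`).

Such a partition needs exponentially many classes (`card_le_log_card_of_isRectangular`). Give each
element at random to one player, who alone may contain it. With few classes, the level-one
inequality and an entropy bound show that on average over coordinates the transcript hardly sees
whether the owner of coordinate `i` has `i`. So the inputs `(0,1)` and `(1,0)` at `i` give close
transcript distributions in Hellinger distance. By cut-and-paste, `(0,0)` and `(1,1)` are equally
close, although the answer must separate them.

With `T` about `n / 4` this yields `t ≥ c * n / (2 ^ r * log n ^ 3)` (`HasGapReductions.rounds_ge`);
the two claims take `r` about `ε * log n / 2` and `log (log n)`. -/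

namespace Congest

set_option linter.unusedSectionVars false

/-! ### Rectangle partitions and set disjointness, by Hellinger distances. -/

section RectanglePartition

variable {ι κ : Type} [Fintype ι] [DecidableEq ι] [Fintype κ] [DecidableEq κ]

/-- The sign `(-1) ^ b` of a bit. -/
def bitSign (b : Bool) : ℝ := if b then -1 else 1

/-- The level-one inequality: a large subset of the cube has few biased coordinates. -/
theorem sum_sq_sum_bitSign_le (S : Finset (ι → Bool)) :
    ∑ i, (∑ z ∈ S, bitSign (z i)) ^ 2 ≤
      2 * (S.card : ℝ) ^ 2 * Real.log ((Fintype.card (ι → Bool) : ℝ) / S.card) := by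
  rcases S.eq_empty_or_nonempty with rfl | hS
  · simp
  have hm : (0 : ℝ) < S.card := by exact_mod_cast hS.card_pos
  set m : ℝ := (S.card : ℝ)
  set N : ℝ := (Fintype.card (ι → Bool) : ℝ) with hN
  -- The linear form `u` below has the average signs on `S` as coefficients, so its mean over `S` is
  -- `s`. Its exponential sums over `S` and over the whole cube are compared.
  set β : ι → ℝ := fun i => (∑ z ∈ S, bitSign (z i)) / m with hβ
  set s : ℝ := ∑ i, β i ^ 2 with hs
  set u : (ι → Bool) → ℝ := fun z => ∑ i, β i * bitSign (z i) with hu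
  have hsum : ∑ z ∈ S, u z = m * s := by
    simp only [hu, hs]
    rw [Finset.sum_comm, Finset.mul_sum]
    refine Finset.sum_congr rfl fun i _ => ?_
    rw [← Finset.mul_sum]
    simp only [hβ]
    field_simp
  have hlow : m * Real.exp s ≤ ∑ z ∈ S, Real.exp (u z) := by
    -- The tangent of `exp` at `s`: Jensen's inequality, pointwise.
    have h1 : ∀ z ∈ S, Real.exp s * (u z - s + 1) ≤ Real.exp (u z) := fun z _ => by
      have h2 := mul_le_mul_of_nonneg_left (Real.add_one_le_exp (u z - s)) (Real.exp_pos s).le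
      rwa [← Real.exp_add, add_sub_cancel] at h2
    have h3 := Finset.sum_le_sum h1
    rw [← Finset.mul_sum, Finset.sum_add_distrib, Finset.sum_sub_distrib, hsum] at h3
    simp only [Finset.sum_const, nsmul_eq_mul] at h3
    change Real.exp s * (m * s - m * s + m * 1) ≤ _ at h3
    linarith
  have hup : ∑ z : ι → Bool, Real.exp (u z) ≤ N * Real.exp (s / 2) := by
    have h1 : ∑ z : ι → Bool, Real.exp (u z) =
        ∏ i, ∑ b : Bool, Real.exp (β i * bitSign b) := by
      rw [Finset.prod_univ_sum, Fintype.piFinset_univ]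
      refine Finset.sum_congr rfl fun z _ => ?_
      rw [Real.exp_sum]
    have h2 : ∀ i, ∑ b : Bool, Real.exp (β i * bitSign b) ≤ 2 * Real.exp (β i ^ 2 / 2) := by
      intro i
      have := Real.cosh_le_exp_half_sq (β i)
      rw [Real.cosh_eq] at this
      simp only [Fintype.sum_bool, bitSign]
      norm_num
      linarith
    rw [h1]
    refine (Finset.prod_le_prod (fun i _ => by positivity) fun i _ => h2 i).trans ?_
    rw [Finset.prod_mul_distrib, ← Real.exp_sum, ← Finset.sum_div, hN]
    simp [hs]
  have hle : m * Real.exp s ≤ N * Real.exp (s / 2) :=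
    hlow.trans ((Finset.sum_le_univ_sum_of_nonneg fun z => (Real.exp_pos _).le).trans hup)
  have hs2 : s / 2 ≤ Real.log (N / m) := by
    rw [Real.le_log_iff_exp_le (by rw [hN]; positivity), le_div_iff₀ hm]
    have h1 : Real.exp s = Real.exp (s / 2) * Real.exp (s / 2) := by
      rw [← Real.exp_add]; ring_nf
    rw [h1] at hle
    have := Real.exp_pos (s / 2)
    nlinarith
  have hfin : ∑ i, (∑ z ∈ S, bitSign (z i)) ^ 2 = m ^ 2 * s := by
    rw [hs, Finset.mul_sum]
    refine Finset.sum_congr rfl fun i _ => ?_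
    simp only [hβ]
    field_simp
  rw [hfin]
  nlinarith [sq_nonneg m]

/-- With `a = p ^ 2` and `b = q ^ 2`, factor `a - b = (p - q) * (p + q)` and use `(p + q) ^ 2 ≥ a +
b`. It converts squared biases into squared Hellinger distances. -/
theorem sq_sqrt_sub_sqrt_mul_add_le {a b : ℝ} (ha : 0 ≤ a) (hb : 0 ≤ b) :
    (√(2 * a) - √(2 * b)) ^ 2 * (a + b) ≤ 2 * (a - b) ^ 2 := by
  rw [Real.sqrt_mul (by norm_num), Real.sqrt_mul (by norm_num), ← mul_sub, mul_pow,
    Real.sq_sqrt (by norm_num)]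
  obtain ⟨p, hp, rfl⟩ : ∃ p, 0 ≤ p ∧ p ^ 2 = a := ⟨√a, Real.sqrt_nonneg _, Real.sq_sqrt ha⟩
  obtain ⟨q, hq, rfl⟩ : ∃ q, 0 ≤ q ∧ q ^ 2 = b := ⟨√b, Real.sqrt_nonneg _, Real.sq_sqrt hb⟩
  rw [Real.sqrt_sq hp, Real.sqrt_sq hq]
  nlinarith [mul_nonneg (sq_nonneg (p - q)) (mul_nonneg hp hq)]

/-- The squared Hellinger distances between the two halves of a subset of the cube. -/
theorem sum_sq_sqrt_card_sub_le (S : Finset (ι → Bool)) :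
    ∑ i, (√(2 * ((S.filter (fun z => z i = false)).card : ℝ)) -
        √(2 * ((S.filter (fun z => z i = true)).card : ℝ))) ^ 2 ≤
      4 * ((S.card : ℝ) * Real.log ((Fintype.card (ι → Bool) : ℝ) / S.card)) := by
  rcases S.eq_empty_or_nonempty with rfl | hS
  · simp
  have hm : (0 : ℝ) < S.card := by exact_mod_cast hS.card_pos
  have hcard : ∀ i, ((S.filter (fun z => z i = false)).card : ℝ) +
      ((S.filter (fun z => z i = true)).card : ℝ) = S.card := by
    intro i
    have := Finset.card_filter_add_card_filter_not (s := S) (fun z => z i = false)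
    simp only [Bool.not_eq_false] at this
    exact_mod_cast this
  have hsgn : ∀ i, ((S.filter (fun z => z i = false)).card : ℝ) -
      ((S.filter (fun z => z i = true)).card : ℝ) = ∑ z ∈ S, bitSign (z i) := by
    intro i
    rw [Finset.card_filter, Finset.card_filter]
    push_cast
    rw [← Finset.sum_sub_distrib]
    refine Finset.sum_congr rfl fun z _ => ?_
    cases z i <;> simp [bitSign]
  refine le_of_mul_le_mul_right ?_ hm
  rw [Finset.sum_mul]
  calc _ ≤ ∑ i, 2 * (∑ z ∈ S, bitSign (z i)) ^ 2 := by
        refine Finset.sum_le_sum fun i _ => ?_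
        rw [← hsgn i, ← hcard i]
        exact sq_sqrt_sub_sqrt_mul_add_le (Nat.cast_nonneg _) (Nat.cast_nonneg _)
    _ ≤ _ := by
        rw [← Finset.mul_sum]
        have := sum_sq_sum_bitSign_le S
        nlinarith

/-- The entropy of a partition into `card κ` classes is at most `log (card κ)`. -/
theorem sum_card_mul_log_le {α : Type} [Fintype α] (g : α → κ) :
    ∑ τ, ((Finset.univ.filter (fun z => g z = τ)).card : ℝ) *
        Real.log ((Fintype.card α : ℝ) / (Finset.univ.filter (fun z => g z = τ)).card) ≤
      Fintype.card α * Real.log (Fintype.card κ) := by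
  rcases isEmpty_or_nonempty α with h | h
  · simp
  have hκ : Nonempty κ := h.map g
  set N : ℝ := (Fintype.card α : ℝ)
  set M : ℝ := (Fintype.card κ : ℝ) with hM'
  have hN : 0 < N := Nat.cast_pos.mpr Fintype.card_pos
  have hM : 0 < M := Nat.cast_pos.mpr Fintype.card_pos
  have hsum : ∑ τ, ((Finset.univ.filter (fun z => g z = τ)).card : ℝ) = N := by
    have := Finset.card_eq_sum_card_fiberwise (s := (Finset.univ : Finset α))
      (t := (Finset.univ : Finset κ)) (f := g) (fun _ _ => Finset.mem_coe.2 (Finset.mem_univ _))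
    rw [Finset.card_univ] at this
    simp only [N]
    rw [this]
    push_cast
    rfl
  have hterm : ∀ τ, ((Finset.univ.filter (fun z => g z = τ)).card : ℝ) *
      Real.log (N / (Finset.univ.filter (fun z => g z = τ)).card) ≤
      ((Finset.univ.filter (fun z => g z = τ)).card : ℝ) * Real.log M +
        (N / M - (Finset.univ.filter (fun z => g z = τ)).card) := by
    intro τ
    set m : ℝ := ((Finset.univ.filter (fun z => g z = τ)).card : ℝ) with hm'
    rcases (Nat.cast_nonneg (α := ℝ) (Finset.univ.filter (fun z => g z = τ)).card).eq_or_lt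
      with h0 | h0
    · rw [← hm'] at h0
      rw [← h0]
      simp
      positivity
    · rw [← hm'] at h0
      -- Comparison with classes of equal size `N / M`: by `log x ≤ x - 1` the excess is at most `N
      -- / M - m`, and these terms sum to zero over the classes.
      have h1 : Real.log (N / m) = Real.log M + Real.log (N / (M * m)) := by
        rw [← Real.log_mul hM.ne' (by positivity)]
        congr 1
        field_simp
      have h2 := Real.log_le_sub_one_of_pos (show 0 < N / (M * m) by positivity)
      have h3 : m * (N / (M * m)) = N / M := by field_simp
      rw [h1]
      nlinarith
  refine (Finset.sum_le_sum fun τ _ => hterm τ).trans ?_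
  rw [Finset.sum_add_distrib, Finset.sum_sub_distrib, ← Finset.sum_mul, hsum]
  simp only [Finset.sum_const, Finset.card_univ, nsmul_eq_mul]
  rw [← hM', mul_div_cancel₀ _ hM.ne']
  linarith

/-- The first of two disjoint sets, which consists of the elements of `z` in `d`, with the
coordinate `i` set to `u`. -/
def leftInput (d : ι → Bool) (i : ι) (u : Bool) (z : ι → Bool) : ι → Bool :=
  Function.update (fun j => d j && z j) i u

/-- The second of two disjoint sets, which consists of the elements of `z` outside `d`, with the
coordinate `i` set to `v`. -/
def rightInput (d : ι → Bool) (i : ι) (v : Bool) (z : ι → Bool) : ι → Bool :=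
  Function.update (fun j => !d j && z j) i v

/-- The number of pairs of inputs with a given transcript. -/
def transcriptCount (f : (ι → Bool) → (ι → Bool) → κ) (d : ι → Bool) (i : ι) (u v : Bool)
    (τ : κ) : ℕ :=
  (Finset.univ.filter (fun z => f (leftInput d i u z) (rightInput d i v z) = τ)).card

theorem sum_transcriptCount (f : (ι → Bool) → (ι → Bool) → κ) (d : ι → Bool) (i : ι)
    (u v : Bool) (s : Finset κ) : ∑ τ ∈ s, transcriptCount f d i u v τ =
      (Finset.univ.filter (fun z => f (leftInput d i u z) (rightInput d i v z) ∈ s)).card := by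
  rw [Finset.card_eq_sum_card_fiberwise (t := s)
    (f := fun z => f (leftInput d i u z) (rightInput d i v z)) (fun z hz => by simpa using hz)]
  refine Finset.sum_congr rfl fun τ hτ => ?_
  rw [transcriptCount, Finset.filter_filter]
  congr 1
  ext z
  simp only [Finset.mem_filter, Finset.mem_univ, true_and]
  constructor
  · rintro rfl; exact ⟨hτ, rfl⟩
  · exact fun h => h.2

/-- A function of two variables whose fibres are combinatorial rectangles. -/
def IsRectangular {α β γ : Type} (f : α → β → γ) : Prop :=
  ∀ x y x' y', f x y = f x' y' → f x y' = f x y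

theorem leftInput_congr {d z z' : ι → Bool} (i : ι) (u : Bool)
    (h : ∀ j, d j = true → z j = z' j) : leftInput d i u z = leftInput d i u z' := by
  have : (fun j => d j && z j) = fun j => d j && z' j := by
    funext j
    by_cases hj : d j = true
    · rw [h j hj]
    · simp [hj]
  rw [leftInput, leftInput, this]

theorem rightInput_congr {d z z' : ι → Bool} (i : ι) (u : Bool)
    (h : ∀ j, d j = false → z j = z' j) : rightInput d i u z = rightInput d i u z' := by
  have : (fun j => !d j && z j) = fun j => !d j && z' j := by
    funext j
    by_cases hj : d j = true
    · simp [hj]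
    · rw [h j (by simpa using hj)]
  rw [rightInput, rightInput, this]

/-- The cut-and-paste property. -/
theorem transcriptCount_mul_transcriptCount {f : (ι → Bool) → (ι → Bool) → κ}
    (hf : IsRectangular f) (d : ι → Bool) (i : ι) (τ : κ) :
    transcriptCount f d i false true τ * transcriptCount f d i true false τ =
      transcriptCount f d i false false τ * transcriptCount f d i true true τ := by
  simp only [transcriptCount]
  rw [← Finset.card_product, ← Finset.card_product]
  -- Exchanging two points outside `d` keeps the left inputs and swaps the right inputs;
  -- rectangularity keeps the transcript equal to `τ`.
  set sw : (ι → Bool) × (ι → Bool) → (ι → Bool) × (ι → Bool) := fun p =>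
    (fun j => if d j then p.1 j else p.2 j, fun j => if d j then p.2 j else p.1 j) with hsw
  have hinv : ∀ p, sw (sw p) = p := by
    intro p
    ext j <;> simp only [hsw] <;> split_ifs <;> rfl
  have hl1 : ∀ p u, leftInput d i u (sw p).1 = leftInput d i u p.1 := fun p u =>
    leftInput_congr i u fun j hj => by simp [hsw, hj]
  have hl2 : ∀ p u, leftInput d i u (sw p).2 = leftInput d i u p.2 := fun p u =>
    leftInput_congr i u fun j hj => by simp [hsw, hj]
  have hr1 : ∀ p u, rightInput d i u (sw p).1 = rightInput d i u p.2 := fun p u =>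
    rightInput_congr i u fun j hj => by simp [hsw, hj]
  have hr2 : ∀ p u, rightInput d i u (sw p).2 = rightInput d i u p.1 := fun p u =>
    rightInput_congr i u fun j hj => by simp [hsw, hj]
  have hcut : ∀ {x x' y y'}, f x y = τ → f x' y' = τ → f x y' = τ := fun h h' =>
    (hf _ _ _ _ (h.trans h'.symm)).trans h
  refine Finset.card_bij' (fun p _ => sw p) (fun p _ => sw p) ?_ ?_ (fun p _ => hinv p)
    (fun p _ => hinv p)
  · intro p hp
    simp only [Finset.mem_product, Finset.mem_filter, Finset.mem_univ, true_and] at hp ⊢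
    rw [hl1, hl2, hr1, hr2]
    exact ⟨hcut hp.1 hp.2, hcut hp.2 hp.1⟩
  · intro p hp
    simp only [Finset.mem_product, Finset.mem_filter, Finset.mem_univ, true_and] at hp ⊢
    rw [hl1, hl2, hr1, hr2]
    exact ⟨hcut hp.1 hp.2, hcut hp.2 hp.1⟩

theorem leftInput_update (d z : ι → Bool) (i : ι) (u c : Bool) :
    leftInput d i u (Function.update z i c) = leftInput d i u z := by
  funext j
  by_cases h : j = i
  · subst h; simp [leftInput]
  · simp [leftInput, h]

theorem rightInput_update (d z : ι → Bool) (i : ι) (u c : Bool) :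
    rightInput d i u (Function.update z i c) = rightInput d i u z := by
  funext j
  by_cases h : j = i
  · subst h; simp [rightInput]
  · simp [rightInput, h]

/-- On points with `z i = c` the inputs already have the prescribed values at `i`. Once coordinate
`i` is overwritten, `z i` is irrelevant, so exactly half of the counted points have `z i = c`. -/
theorem two_mul_card_filter_eq_transcriptCount (f : (ι → Bool) → (ι → Bool) → κ) (d : ι → Bool)
    (i : ι) (τ : κ) (c : Bool) :
    2 * (((Finset.univ.filter (fun z : ι → Bool =>
        f (fun j => d j && z j) (fun j => !d j && z j) = τ)).filter
          (fun z => z i = c)).card) =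
      transcriptCount f d i (d i && c) (!d i && c) τ := by
  rw [transcriptCount]
  set Q := Finset.univ.filter (fun z => f (leftInput d i (d i && c) z)
    (rightInput d i (!d i && c) z) = τ) with hQ
  have h1 : (Finset.univ.filter (fun z : ι → Bool =>
        f (fun j => d j && z j) (fun j => !d j && z j) = τ)).filter (fun z => z i = c) =
      Q.filter (fun z => z i = c) := by
    ext z
    simp only [hQ, Finset.mem_filter, Finset.mem_univ, true_and]
    refine and_congr_left fun hz => ?_
    have hl : leftInput d i (d i && c) z = fun j => d j && z j := by
      rw [leftInput, Function.update_eq_self_iff, hz]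
    have hr : rightInput d i (!d i && c) z = fun j => !d j && z j := by
      rw [rightInput, Function.update_eq_self_iff, hz]
    rw [hl, hr]
  have h2 : (Q.filter (fun z => z i = c)).card = (Q.filter (fun z => ¬ z i = c)).card := by
    refine Finset.card_bij' (fun z _ => Function.update z i (!c))
      (fun z _ => Function.update z i c) ?_ ?_ ?_ ?_
    · intro z hz
      simp only [hQ, Finset.mem_filter, Finset.mem_univ, true_and] at hz ⊢
      rw [leftInput_update, rightInput_update]
      exact ⟨hz.1, by simp⟩
    · intro z hz
      simp only [hQ, Finset.mem_filter, Finset.mem_univ, true_and] at hz ⊢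
      rw [leftInput_update, rightInput_update]
      exact ⟨hz.1, by simp⟩
    · intro z hz
      simp only [Finset.mem_filter] at hz
      simp [← hz.2]
    · intro z hz
      simp only [Finset.mem_filter] at hz
      have : (!c) = z i := by
        have := hz.2
        revert this
        cases z i <;> cases c <;> simp
      simp [this]
  have h3 := Finset.card_filter_add_card_filter_not (s := Q) (fun z => z i = c)
  rw [h1]
  omega

theorem leftInput_update_base (d z : ι → Bool) (i : ι) (u c : Bool) :
    leftInput (Function.update d i c) i u z = leftInput d i u z := by
  funext j
  by_cases h : j = i
  · subst h; simp [leftInput]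
  · simp [leftInput, h]

theorem rightInput_update_base (d z : ι → Bool) (i : ι) (u c : Bool) :
    rightInput (Function.update d i c) i u z = rightInput d i u z := by
  funext j
  by_cases h : j = i
  · subst h; simp [rightInput]
  · simp [rightInput, h]

/-- For fixed `d` the transcript partitions the cube of all `z`. The level-one inequality handles
each class, and the entropy bound adds the classes up. At coordinate `i` the two halves of a class
correspond to the inputs `(0,0)` and `(d i, !d i)`. -/
theorem sum_sum_sq_sqrt_transcriptCount_le (f : (ι → Bool) → (ι → Bool) → κ) (d : ι → Bool) :
    ∑ i, ∑ τ, (√(transcriptCount f d i false false τ : ℝ) -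
        √(transcriptCount f d i (d i) (!d i) τ : ℝ)) ^ 2 ≤
      4 * (Fintype.card (ι → Bool) * Real.log (Fintype.card κ)) := by
  rw [Finset.sum_comm]
  have h := sum_card_mul_log_le (fun z : ι → Bool => f (fun j => d j && z j) (fun j => !d j && z j))
  refine le_trans ?_ (mul_le_mul_of_nonneg_left h (by norm_num))
  rw [Finset.mul_sum]
  refine Finset.sum_le_sum fun τ _ => ?_
  refine le_trans (le_of_eq ?_) (sum_sq_sqrt_card_sub_le _)
  refine Finset.sum_congr rfl fun i _ => ?_
  have h0 := two_mul_card_filter_eq_transcriptCount f d i τ false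
  have h1 := two_mul_card_filter_eq_transcriptCount f d i τ true
  simp only [Bool.and_false, Bool.and_true] at h0 h1
  rw [← h0, ← h1]
  push_cast
  rfl

/-- Flipping `d i` leaves `g` unchanged, so the choices `b = d i` and `b = !d i` contribute equally.
This frees the input at `i` from the owner prescribed by `d`. -/
theorem sum_sum_add_eq_two_mul (i : ι) (g : (ι → Bool) → Bool → ℝ)
    (hg : ∀ d c b, g (Function.update d i c) b = g d b) :
    ∑ d, (g d false + g d true) = 2 * ∑ d, g d (d i) := by
  have h1 : ∑ d, g d (d i) = ∑ d, g d (!d i) := by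
    refine Finset.sum_bij' (fun d _ => Function.update d i (!d i))
      (fun d _ => Function.update d i (!d i)) (by simp) (by simp) (by simp) (by simp) ?_
    intro d _
    simp [hg]
  rw [two_mul]
  nth_rw 2 [h1]
  rw [← Finset.sum_add_distrib]
  refine Finset.sum_congr rfl fun d _ => ?_
  cases d i <;> simp [add_comm]

theorem transcriptCount_update (f : (ι → Bool) → (ι → Bool) → κ) (d : ι → Bool) (i : ι)
    (u v c : Bool) (τ : κ) :
    transcriptCount f (Function.update d i c) i u v τ = transcriptCount f d i u v τ := by
  simp only [transcriptCount, leftInput_update_base, rightInput_update_base]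

/-- Triangle inequality through the input `(0,0)`: after averaging over `d`, both `(0,1)` and
`(1,0)` are close to it. -/
theorem sum_sq_sqrt_cross_le (f : (ι → Bool) → (ι → Bool) → κ) :
    ∑ i, ∑ d, ∑ τ, (√(transcriptCount f d i false true τ : ℝ) -
        √(transcriptCount f d i true false τ : ℝ)) ^ 2 ≤
      16 * ((Fintype.card (ι → Bool) : ℝ) ^ 2 * Real.log (Fintype.card κ)) := by
  set g : ι → (ι → Bool) → Bool → ℝ := fun i d b =>
    ∑ τ, (√(transcriptCount f d i false false τ : ℝ) -
        √(transcriptCount f d i b (!b) τ : ℝ)) ^ 2 with hg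
  have h1 : ∀ i d, ∑ τ, (√(transcriptCount f d i false true τ : ℝ) -
        √(transcriptCount f d i true false τ : ℝ)) ^ 2 ≤ 2 * (g i d false + g i d true) := by
    intro i d
    simp only [hg]
    rw [← Finset.sum_add_distrib, Finset.mul_sum]
    refine Finset.sum_le_sum fun τ _ => ?_
    simp only [Bool.not_false, Bool.not_true]
    nlinarith [sq_nonneg ((√(transcriptCount f d i false true τ : ℝ) -
      √(transcriptCount f d i false false τ : ℝ)) - (√(transcriptCount f d i false false τ : ℝ) -
        √(transcriptCount f d i true false τ : ℝ)))]
  have h2 : ∀ i, ∑ d, (g i d false + g i d true) = 2 * ∑ d, g i d (d i) := fun i =>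
    sum_sum_add_eq_two_mul i (g i) fun d c b => by simp only [hg, transcriptCount_update]
  calc _ ≤ ∑ i, ∑ d, 2 * (g i d false + g i d true) :=
        Finset.sum_le_sum fun i _ => Finset.sum_le_sum fun d _ => h1 i d
    _ = 4 * ∑ d, ∑ i, g i d (d i) := by
        rw [Finset.sum_comm (s := (Finset.univ : Finset (ι → Bool))), Finset.mul_sum]
        refine Finset.sum_congr rfl fun i _ => ?_
        rw [← Finset.mul_sum, h2]
        ring
    _ ≤ 4 * ∑ _d : ι → Bool, 4 * (Fintype.card (ι → Bool) * Real.log (Fintype.card κ)) := by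
        gcongr with d
        exact sum_sum_sq_sqrt_transcriptCount_le f d
    _ = _ := by
        rw [Finset.sum_const, Finset.card_univ, nsmul_eq_mul]
        ring

/-- AM-GM, where `3/4 * 1/3 = 1/4`. The larger weight will fall on the small mass of erroneous
answers, the smaller on the mass of correct ones. -/
theorem sqrt_mul_le_weighted {p q : ℝ} (hp : 0 ≤ p) (hq : 0 ≤ q) :
    √(p * q) ≤ 3 / 4 * p + 1 / 3 * q := by
  refine Real.sqrt_le_iff.2 ⟨by positivity, ?_⟩
  nlinarith [sq_nonneg (3 / 4 * p - 1 / 3 * q)]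

/-- A partition into rectangles whose classes tell the disjoint pairs from the pairs with one common
element has exponentially many classes: here the errors are counted over all `i`, `d` and `z`. -/
theorem card_le_log_card_of_isRectangular {f : (ι → Bool) → (ι → Bool) → κ} (hf : IsRectangular f)
    (acc : Finset κ)
    (herr : ∑ i, ∑ d : ι → Bool, (((Finset.univ.filter (fun z : ι → Bool =>
        f (leftInput d i false z) (rightInput d i false z) ∈ acc)).card : ℝ) +
      ((Finset.univ.filter (fun z : ι → Bool =>
        f (leftInput d i true z) (rightInput d i true z) ∈ accᶜ)).card : ℝ)) ≤
      2 / 3 * (Fintype.card ι * (Fintype.card (ι → Bool) : ℝ) ^ 2)) :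
    (Fintype.card ι : ℝ) ≤ 144 * Real.log (Fintype.card κ) := by
  set N : ℝ := (Fintype.card (ι → Bool) : ℝ) with hN
  have hNpos : 0 < N := by rw [hN]; positivity
  have htot : ∀ i d u v, ∑ τ, (transcriptCount f d i u v τ : ℝ) = N := by
    intro i d u v
    have := sum_transcriptCount f d i u v Finset.univ
    simp only [Finset.mem_univ, Finset.filter_true, Finset.card_univ] at this
    rw [hN]
    exact_mod_cast this
  have hsplit : ∀ g : κ → ℝ, ∑ τ, g τ = ∑ τ ∈ acc, g τ + ∑ τ ∈ accᶜ, g τ := fun g =>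
    (Finset.sum_add_sum_compl acc g).symm
  -- With error mass `e`, the weights bound the affinity of `(0,0)` and `(1,1)` by `2/3 * N + 5/12 *
  -- e`, and the squared distance is `2 * N` minus twice the affinity.
  have hone : ∀ i d, 2 / 3 * N - 5 / 6 * (((Finset.univ.filter (fun z : ι → Bool =>
        f (leftInput d i false z) (rightInput d i false z) ∈ acc)).card : ℝ) +
      ((Finset.univ.filter (fun z : ι → Bool =>
        f (leftInput d i true z) (rightInput d i true z) ∈ accᶜ)).card : ℝ)) ≤
      ∑ τ, (√(transcriptCount f d i false true τ : ℝ) -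
        √(transcriptCount f d i true false τ : ℝ)) ^ 2 := by
    intro i d
    have e0 : ((Finset.univ.filter (fun z : ι → Bool => f (leftInput d i false z)
        (rightInput d i false z) ∈ acc)).card : ℝ) =
        ∑ τ ∈ acc, (transcriptCount f d i false false τ : ℝ) := by
      exact_mod_cast (sum_transcriptCount f d i false false acc).symm
    have e1 : ((Finset.univ.filter (fun z : ι → Bool => f (leftInput d i true z)
        (rightInput d i true z) ∈ accᶜ)).card : ℝ) =
        ∑ τ ∈ accᶜ, (transcriptCount f d i true true τ : ℝ) := by
      exact_mod_cast (sum_transcriptCount f d i true true accᶜ).symm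
    have hexp : ∑ τ, (√(transcriptCount f d i false true τ : ℝ) -
        √(transcriptCount f d i true false τ : ℝ)) ^ 2 = 2 * N -
        2 * ∑ τ, √((transcriptCount f d i false false τ : ℝ) *
          (transcriptCount f d i true true τ : ℝ)) := by
      rw [Finset.mul_sum, two_mul N]
      nth_rw 1 [← htot i d false true]
      rw [← htot i d true false, ← Finset.sum_add_distrib, ← Finset.sum_sub_distrib]
      refine Finset.sum_congr rfl fun τ _ => ?_
      have h := transcriptCount_mul_transcriptCount hf d i τ
      have h' : (transcriptCount f d i false true τ : ℝ) * transcriptCount f d i true false τ =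
        transcriptCount f d i false false τ * transcriptCount f d i true true τ := by
        exact_mod_cast h
      rw [← h', Real.sqrt_mul (Nat.cast_nonneg _), sub_sq, Real.sq_sqrt (Nat.cast_nonneg _),
        Real.sq_sqrt (Nat.cast_nonneg _)]
      ring
    have hb : ∑ τ, √((transcriptCount f d i false false τ : ℝ) *
          (transcriptCount f d i true true τ : ℝ)) ≤
        (3 / 4 * ∑ τ ∈ acc, (transcriptCount f d i false false τ : ℝ) +
          1 / 3 * ∑ τ ∈ acc, (transcriptCount f d i true true τ : ℝ)) +
        (3 / 4 * ∑ τ ∈ accᶜ, (transcriptCount f d i true true τ : ℝ) +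
          1 / 3 * ∑ τ ∈ accᶜ, (transcriptCount f d i false false τ : ℝ)) := by
      rw [hsplit]
      refine add_le_add ?_ ?_
      · rw [Finset.mul_sum, Finset.mul_sum, ← Finset.sum_add_distrib]
        exact Finset.sum_le_sum fun τ _ =>
          sqrt_mul_le_weighted (Nat.cast_nonneg _) (Nat.cast_nonneg _)
      · rw [Finset.mul_sum, Finset.mul_sum, ← Finset.sum_add_distrib]
        refine Finset.sum_le_sum fun τ _ => ?_
        rw [mul_comm (transcriptCount f d i false false τ : ℝ)]
        exact sqrt_mul_le_weighted (Nat.cast_nonneg _) (Nat.cast_nonneg _)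
    have t0 := htot i d false false
    have t1 := htot i d true true
    rw [hsplit] at t0 t1
    rw [hexp, e0, e1]
    linarith
  have hall := (Finset.sum_le_sum fun i (_ : i ∈ Finset.univ) => Finset.sum_le_sum
    fun d (_ : d ∈ Finset.univ) => hone i d).trans (sum_sq_sqrt_cross_le f)
  simp only [Finset.sum_sub_distrib, ← Finset.mul_sum, Finset.sum_const, Finset.card_univ,
    nsmul_eq_mul] at hall
  rw [← hN] at hall
  -- The allowed error leaves `2/3 - 5/6 * 2/3 = 1/9`, whence `144 = 9 * 16`.
  have hfin : (Fintype.card ι : ℝ) * N ^ 2 ≤ 144 * Real.log (Fintype.card κ) * N ^ 2 := by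
    nlinarith
  exact le_of_mul_le_mul_right hfin (by positivity)

end RectanglePartition

end Congest
namespace Congest

/-! ### Universal matrices, by the probabilistic method. -/

theorem card_filter_agree_mul {ι : Type} [Fintype ι] [DecidableEq ι] (s : Finset ι)
    (σ : ι → Bool) :
    (Finset.univ.filter (fun c : ι → Bool => ∀ i ∈ s, c i = σ i)).card * 2 ^ s.card =
      Fintype.card (ι → Bool) := by
  have h : Finset.univ.filter (fun c : ι → Bool => ∀ i ∈ s, c i = σ i) =
      Fintype.piFinset (fun i => if i ∈ s then {σ i} else Finset.univ) := by
    ext c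
    simp only [Finset.mem_filter, Finset.mem_univ, true_and, Fintype.mem_piFinset]
    refine forall_congr' fun i => ?_
    split_ifs with hi <;> simp [hi]
  have hp : ∀ i, (if i ∈ s then ({σ i} : Finset Bool) else Finset.univ).card =
      if i ∈ s then 1 else 2 := fun i => by split_ifs <;> simp
  rw [h, Fintype.card_piFinset, Finset.prod_congr rfl fun i _ => hp i, Finset.prod_ite]
  simp only [Finset.prod_const, one_pow, one_mul, Fintype.card_pi, Fintype.card_bool,
    Finset.card_univ]
  rw [← pow_add, ← Finset.card_univ (α := ι),
    ← Finset.card_filter_add_card_filter_not (s := Finset.univ) (fun i => i ∈ s),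
    Finset.filter_mem_eq_inter, Finset.univ_inter, add_comm]

/-- A matrix of logarithmically many rows in which every pattern on at most `r` columns occurs. -/
theorem exists_universal_matrix {T r ℓ : ℕ} (hℓ : 2 ^ r * (r * Real.log (2 * T)) < (ℓ : ℝ)) :
    ∃ M : Fin ℓ → Fin T → Bool, ∀ s : Finset (Fin T), s.card ≤ r → ∀ σ : Fin T → Bool,
      ∃ j, ∀ i ∈ s, M j i = σ i := by
  have hℓ0 : 0 < ℓ := by
    by_contra h0
    have h1 : ℓ = 0 := by omega
    subst h1
    have h2 : 0 ≤ Real.log (2 * T) := by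
      have := Real.log_natCast_nonneg (2 * T)
      push_cast at this
      exact this
    have : (0 : ℝ) ≤ 2 ^ r * (r * Real.log (2 * T)) := by positivity
    simp at hℓ
    linarith
  by_contra hcon
  push Not at hcon
  set Q : (Fin r → Fin T × Bool) → Finset (Fin T → Bool) := fun P =>
    Finset.univ.filter (fun c => ∀ a, c (P a).1 = (P a).2) with hQ
  -- Patterns are listed as sequences of `r` requirements, possibly repeated. Contradictory
  -- sequences have empty `Q` and drop out here; the others hold for at least a fraction `2⁻ʳ` of
  -- all rows.
  set bad : Finset (Fin r → Fin T × Bool) :=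
    Finset.univ.filter (fun P => Fintype.card (Fin T → Bool) ≤ (Q P).card * 2 ^ r) with hbad
  have hcov : (Finset.univ : Finset (Fin ℓ → Fin T → Bool)) ⊆
      bad.biUnion fun P => Fintype.piFinset fun _ => (Q P)ᶜ := by
    intro M _
    obtain ⟨s, hs, σ, hσ⟩ := hcon M
    -- A surjection from `Fin r` onto `s` requires a point of `s`; row `0` exists and misses the
    -- pattern somewhere in `s`.
    have hne : s.Nonempty := by
      obtain ⟨i, hi, -⟩ := hσ ⟨0, hℓ0⟩
      exact ⟨i, hi⟩
    have : Nonempty s := hne.to_subtype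
    obtain ⟨e⟩ : Nonempty (s ↪ Fin r) :=
      Function.Embedding.nonempty_of_card_le (by simpa using hs)
    set p : Fin r → s := Function.invFun e
    have hp : Function.Surjective p := Function.invFun_surjective e.injective
    refine Finset.mem_biUnion.2 ⟨fun a => (p a, σ (p a)), ?_, ?_⟩
    · have hQs : Q (fun a => ((p a : Fin T), σ (p a))) =
          Finset.univ.filter (fun c : Fin T → Bool => ∀ i ∈ s, c i = σ i) := by
        ext c
        simp only [hQ, Finset.mem_filter, Finset.mem_univ, true_and]
        constructor
        · intro h i hi
          obtain ⟨a, ha⟩ := hp ⟨i, hi⟩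
          have := h a
          rwa [ha] at this
        · exact fun h a => h _ (p a).2
      simp only [hbad, Finset.mem_filter, Finset.mem_univ, true_and]
      rw [hQs, ← card_filter_agree_mul s σ]
      exact Nat.mul_le_mul (Finset.card_le_card fun c hc => by simpa using hc)
        (Nat.pow_le_pow_right Nat.two_pos hs)
    · rw [Fintype.mem_piFinset]
      intro j
      obtain ⟨i, hi, hne⟩ := hσ j
      obtain ⟨a, ha⟩ := hp ⟨i, hi⟩
      simp only [hQ, Finset.mem_compl, Finset.mem_filter, Finset.mem_univ, true_and]
      intro h
      have := h a
      rw [ha] at this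
      exact hne this
  have hcard := (Finset.card_le_card hcov).trans Finset.card_biUnion_le
  rw [Finset.card_univ, Fintype.card_fun, Fintype.card_fin] at hcard
  set W : ℝ := (Fintype.card (Fin T → Bool) : ℝ) with hW
  have hWpos : 0 < W := by rw [hW]; positivity
  have hterm : ∀ P ∈ bad, ((Fintype.piFinset fun _ : Fin ℓ => (Q P)ᶜ).card : ℝ) ≤
      W ^ ℓ * Real.exp (-(ℓ / 2 ^ r)) := by
    intro P hP
    rw [Fintype.card_piFinset, Finset.prod_const, Finset.card_univ, Fintype.card_fin,
      Finset.card_compl, Nat.cast_pow, Nat.cast_sub (Finset.card_le_univ _)]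
    have h1 : W ≤ (Q P).card * 2 ^ r := by
      have := (Finset.mem_filter.1 hP).2
      rw [hW]
      exact_mod_cast this
    have h2 : Real.exp (-(ℓ / 2 ^ r : ℝ)) = Real.exp (-(1 / 2 ^ r)) ^ ℓ := by
      rw [← Real.exp_nat_mul]
      congr 1
      ring
    rw [h2, ← mul_pow]
    refine pow_le_pow_left₀ ?_ ?_ _
    · rw [sub_nonneg]
      exact_mod_cast Finset.card_le_univ _
    · have h3 := Real.add_one_le_exp (-(1 / 2 ^ r : ℝ))
      have h4 : W / 2 ^ r ≤ (Q P).card := by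
        rw [div_le_iff₀ (by positivity)]
        exact h1
      calc W - (Q P).card ≤ W - W / 2 ^ r := by linarith
        _ = W * (-(1 / 2 ^ r) + 1) := by ring
        _ ≤ _ := by gcongr
  have hreal : W ^ ℓ ≤ (2 * T : ℝ) ^ r * (W ^ ℓ * Real.exp (-(ℓ / 2 ^ r))) := by
    have h1 : W ^ ℓ ≤ ∑ P ∈ bad, ((Fintype.piFinset fun _ : Fin ℓ => (Q P)ᶜ).card : ℝ) := by
      rw [hW]
      exact_mod_cast hcard
    refine (h1.trans (Finset.sum_le_sum hterm)).trans ?_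
    rw [Finset.sum_const, nsmul_eq_mul]
    refine mul_le_mul_of_nonneg_right ?_ (by positivity)
    have h2 : bad.card ≤ (T * 2) ^ r := by
      refine (Finset.card_le_univ _).trans ?_
      simp
    calc (bad.card : ℝ) ≤ ((T * 2) ^ r : ℕ) := by exact_mod_cast h2
      _ = _ := by push_cast; ring
  -- Union bound: at most `(2T)^r` patterns, each missed by all `ℓ` independent rows with
  -- probability at most `exp (-ℓ / 2^r)`.
  have h5 : 1 ≤ (2 * T : ℝ) ^ r * Real.exp (-(ℓ / 2 ^ r)) := by
    have : W ^ ℓ * 1 ≤ W ^ ℓ * ((2 * T : ℝ) ^ r * Real.exp (-(ℓ / 2 ^ r))) := by linarith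
    exact le_of_mul_le_mul_left this (by positivity)
  rw [Real.exp_neg, ← div_eq_mul_inv, le_div_iff₀ (Real.exp_pos _), one_mul] at h5
  have h6 : (ℓ : ℝ) / 2 ^ r ≤ r * Real.log (2 * T) := by
    rw [← Real.log_pow]
    exact (Real.le_log_iff_exp_le (lt_of_lt_of_le (Real.exp_pos _) h5)).2 h5
  rw [div_le_iff₀ (by positivity)] at h6
  linarith

end Congest
namespace Congest

/-! ### Two-party simulation across a cut, and fixing the coins. -/

section Simulation

variable {n : ℕ} {Loc Out α β : Type} {B : ℕ}

open Classical in
/-- The arcs of a network that cross a cut, in both directions. -/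
noncomputable def cutArcs (G : SimpleGraph (Fin n)) (side : Fin n → Bool) :
    Finset (Fin n × Fin n) :=
  Finset.univ.filter fun e => G.Adj e.1 e.2 ∧ side e.1 ≠ side e.2

/-- The messages that cross a cut in the first `t` rounds. -/
noncomputable def Algorithm.transcript (A : Algorithm n Loc Out B) (G : SimpleGraph (Fin n))
    (side : Fin n → Bool) (X : Fin n → Loc) (t : ℕ) :
    Fin t → cutArcs G side → Fin B → Option Bool :=
  -- Optional bits also record where a message ends; they give three values per position.
  fun s e b => (A.send (A.state G X s e.1.1) e.1.2)[(b : ℕ)]?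

theorem Algorithm.send_eq_of_getElem?_eq (A : Algorithm n Loc Out B) {s s' : A.State} {u : Fin n}
    (h : ∀ b : Fin B, (A.send s u)[(b : ℕ)]? = (A.send s' u)[(b : ℕ)]?) :
    A.send s u = A.send s' u := by
  refine List.ext_getElem? fun b => ?_
  by_cases hb : b < B
  · exact h ⟨b, hb⟩
  · rw [List.getElem?_eq_none ((A.length_send_le s u).trans (not_lt.1 hb)),
      List.getElem?_eq_none ((A.length_send_le s' u).trans (not_lt.1 hb))]

/-- If the same messages cross the cut on two inputs, then on the mixed input each side behaves as
on the input from which its part is taken. -/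
theorem Algorithm.state_mixed (A : Algorithm n Loc Out B) (G : SimpleGraph (Fin n))
    (side : Fin n → Bool) {t : ℕ} {X X' Y : Fin n → Loc}
    (h : A.transcript G side X t = A.transcript G side X' t)
    (hl : ∀ v, side v = true → Y v = X v) (hr : ∀ v, side v = false → Y v = X' v) :
    ∀ s ≤ t, ∀ v, (side v = true → A.state G Y s v = A.state G X s v) ∧
      (side v = false → A.state G Y s v = A.state G X' s v) := by
  have hsend : ∀ s, s < t → ∀ u v, G.Adj u v → side u ≠ side v →
      A.send (A.state G X s u) v = A.send (A.state G X' s u) v := by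
    intro s hs u v huv hne
    refine A.send_eq_of_getElem?_eq fun b => ?_
    have hmem : (u, v) ∈ cutArcs G side := by simp [cutArcs, huv, hne]
    exact congrFun (congrFun (congrFun h ⟨s, hs⟩) ⟨(u, v), hmem⟩) b
  intro s
  induction s with
  | zero =>
    intro _ v
    refine ⟨fun hv => ?_, fun hv => ?_⟩
    · simp only [Algorithm.state, hl v hv]
    · simp only [Algorithm.state, hr v hv]
  | succ s ih =>
    intro hs v
    have ih' := ih (by omega)
    refine ⟨fun hv => ?_, fun hv => ?_⟩
    · simp only [Algorithm.state]
      rw [(ih' v).1 hv]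
      congr 1
      funext u
      split_ifs with hu
      · cases hsu : side u
        -- A neighbour across the cut is in its state for `X'`, but since the transcripts agree its
        -- message is also the one sent on `X`.
        · rw [(ih' u).2 hsu, hsend s hs u v hu (by simp [hsu, hv])]
        · rw [(ih' u).1 hsu]
      · rfl
    · simp only [Algorithm.state]
      rw [(ih' v).2 hv]
      congr 1
      funext u
      split_ifs with hu
      · cases hsu : side u
        · rw [(ih' u).2 hsu]
        · rw [(ih' u).1 hsu, hsend s hs u v hu (by simp [hsu, hv])]
      · rfl

end Simulation

/-- The expected number of failures over the finite family is at most a third of its size, so some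
coin tosses do no worse. -/
theorem exists_card_filter_notMem_le {J Ω : Type} [Fintype J] [MeasurableSpace Ω] (μ : Measure Ω)
    [IsProbabilityMeasure μ] (S : J → Set Ω) (hS : ∀ j, MeasurableSet (S j))
    (h : ∀ j, 2 / 3 ≤ μ (S j)) :
    ∃ ω, ∑ j, ((S j)ᶜ).indicator (fun _ => (1 : ℝ)) ω ≤ 1 / 3 * Fintype.card J := by
  have hint : ∀ j, Integrable (((S j)ᶜ).indicator (fun _ => (1 : ℝ))) μ := fun j =>
    (integrable_const (1 : ℝ)).indicator (hS j).compl
  obtain ⟨ω, hω⟩ := exists_le_integral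
    (integrable_finsetSum Finset.univ fun j _ => hint j)
  refine ⟨ω, hω.trans ?_⟩
  rw [integral_finsetSum _ fun j _ => hint j]
  have hj : ∀ j, ∫ ω, ((S j)ᶜ).indicator (fun _ => (1 : ℝ)) ω ∂μ ≤ 1 / 3 := by
    intro j
    rw [integral_indicator_const _ (hS j).compl, smul_eq_mul, mul_one,
      probReal_compl_eq_one_sub (hS j)]
    have : (2 / 3 : ℝ) ≤ μ.real (S j) := by
      have := ENNReal.toReal_mono (measure_ne_top μ _) (h j)
      simpa [Measure.real] using this
    linarith
  refine (Finset.sum_le_sum fun j _ => hj j).trans ?_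
  simp only [Finset.sum_const, Finset.card_univ, nsmul_eq_mul]
  linarith

/-! ### From gap reductions to bounds on the number of rounds. -/

/-- A reduction from set disjointness on `T` elements to a distributed minimization problem, with a
fixed network in which `c` arcs cross between the two players' sides: the optimum is at most `2` for
intersecting sets and more than `r` for disjoint sets. -/
structure GapReduction {n : ℕ} (P : MinProblem n) (T r c : ℕ) where
  inst : (Fin T → Bool) → (Fin T → Bool) → P.Inst
  graph : SimpleGraph (Fin n)
  network_eq : ∀ x y, P.network (inst x y) = graph
  side : Fin n → Bool
  view_left : ∀ x y y' v, side v = true → P.view (inst x y) v = P.view (inst x y') v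
  view_right : ∀ x x' y v, side v = false → P.view (inst x y) v = P.view (inst x' y) v
  card_cutArcs_le : (cutArcs graph side).card ≤ c
  costLeft : (Fin T → Bool) → (Fin n → P.Out) → ℕ
  costRight : (Fin T → Bool) → (Fin n → P.Out) → ℕ
  cost_eq : ∀ x y o, P.cost (inst x y) o = costLeft x o + costRight y o
  costLeft_congr : ∀ x o o', (∀ v, side v = true → o v = o' v) → costLeft x o = costLeft x o'
  costRight_congr : ∀ y o o', (∀ v, side v = false → o v = o' v) → costRight y o = costRight y o'
  lt_cost : ∀ x y, (∀ i, ¬ (x i = true ∧ y i = true)) → ∀ o, P.Feasible (inst x y) o →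
    r < P.cost (inst x y) o
  exists_cost_le : ∀ x y i, x i = true → y i = true → ∃ o, P.Feasible (inst x y) o ∧
    P.cost (inst x y) o ≤ 2

namespace GapReduction

variable {n : ℕ} {P : MinProblem n} {T r c B : ℕ}

/-- The outputs on the instance of the reduction. -/
noncomputable def outputs (R : GapReduction P T r c) (A : Algorithm n P.Loc P.Out B) (t : ℕ)
    (x y : Fin T → Bool) : Fin n → P.Out :=
  A.run R.graph (P.view (R.inst x y)) t

/-- The communication of the two players, including the costs of their parts of the solution. -/
noncomputable def protocol (R : GapReduction P T r c) (A : Algorithm n P.Loc P.Out B) (t : ℕ)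
    (x y : Fin T → Bool) :
    (Fin t → cutArcs R.graph R.side → Fin B → Option Bool) × Fin (r + 2) × Fin (r + 2) :=
  (A.transcript R.graph R.side (P.view (R.inst x y)) t,
    -- Truncation at `r + 1` leaves `r + 2` values and still decides whether the total cost is at
    -- most `r`.
    ⟨min (R.costLeft x (R.outputs A t x y)) (r + 1), by omega⟩,
    ⟨min (R.costRight y (R.outputs A t x y)) (r + 1), by omega⟩)

/-- By the mixing property, on `(x, y')` each side behaves as on its own pair. Each message is
determined by its sender's side, and each partial cost by the outputs and input of one side. -/
theorem isRectangular_protocol (R : GapReduction P T r c) (A : Algorithm n P.Loc P.Out B)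
    (t : ℕ) : IsRectangular (R.protocol A t) := by
  intro x y x' y' h
  simp only [protocol, Prod.mk.injEq, Fin.mk.injEq] at h ⊢
  obtain ⟨h1, h2, h3⟩ := h
  have key := A.state_mixed R.graph R.side h1
    (fun v hv => R.view_left x y' y v hv) (fun v hv => R.view_right x x' y' v hv)
  refine ⟨?_, ?_, ?_⟩
  · funext s e b
    cases hs : R.side e.1.1
    · have : A.transcript R.graph R.side (P.view (R.inst x y)) t s e b =
          A.transcript R.graph R.side (P.view (R.inst x' y')) t s e b := by rw [h1]
      rw [this]
      simp only [Algorithm.transcript]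
      rw [(key s s.2.le _).2 hs]
    · simp only [Algorithm.transcript]
      rw [(key s s.2.le _).1 hs]
  · rw [R.costLeft_congr x (R.outputs A t x y') (R.outputs A t x y)]
    intro v hv
    simp only [outputs, Algorithm.run]
    rw [(key t le_rfl v).1 hv]
  · rw [R.costRight_congr y' (R.outputs A t x y') (R.outputs A t x' y'), h3]
    intro v hv
    simp only [outputs, Algorithm.run]
    rw [(key t le_rfl v).2 hv]

/-- Call an outcome accepted if its cost is at most `r`. Acceptance on disjoint inputs means an
infeasible output; rejection on intersecting inputs means cost at least `r + 1 > 2 * ρ`. Either way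
the algorithm fails. Averaging over the `2 * T * (2 ^ T) ^ 2` choices of `(i, d, z, b)` fixes coins
with total error within the bound for rectangle partitions. -/
theorem card_le_of_isApproxAlgorithm (R : GapReduction P T r c) {Ω : Type} [MeasurableSpace Ω]
    (μ : Measure Ω) [IsProbabilityMeasure μ] (A : Ω → Algorithm n P.Loc P.Out B) {ρ : ℝ}
    (hρ : 2 * ρ < r + 1) {t : ℕ} (hA : P.IsApproxAlgorithm μ A ρ t) :
    (T : ℝ) ≤ 144 * (B * t * c * Real.log 3 + 2 * Real.log (r + 2)) := by
  classical
  let κ := (Fin t → cutArcs R.graph R.side → Fin B → Option Bool) × Fin (r + 2) × Fin (r + 2)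
  have : DecidableEq κ := Classical.decEq _
  set X : Fin T × (Fin T → Bool) × (Fin T → Bool) × Bool → Fin T → Bool := fun j =>
    leftInput j.2.1 j.1 j.2.2.2 j.2.2.1
  set Y : Fin T × (Fin T → Bool) × (Fin T → Bool) × Bool → Fin T → Bool := fun j =>
    rightInput j.2.1 j.1 j.2.2.2 j.2.2.1
  obtain ⟨ω, hω⟩ := exists_card_filter_notMem_le μ
    (fun j => {ω | P.IsApprox (R.inst (X j) (Y j)) ρ ((A ω).run (P.network (R.inst (X j) (Y j)))
      (P.view (R.inst (X j) (Y j))) t)}) (fun j => (hA _).1) (fun j => (hA _).2)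
  set acc : Finset κ :=
    Finset.univ.filter fun τ => (τ.2.1 : ℕ) + τ.2.2 ≤ r with hacc
  have hmem : ∀ x y, R.protocol (A ω) t x y ∈ acc ↔
      P.cost (R.inst x y) (R.outputs (A ω) t x y) ≤ r := by
    intro x y
    rw [R.cost_eq]
    simp only [hacc, protocol, Finset.mem_filter, Finset.mem_univ, true_and]
    omega
  have hdisj : ∀ d i z, R.protocol (A ω) t (leftInput d i false z) (rightInput d i false z) ∈ acc →
      ω ∉ {ω | P.IsApprox (R.inst (X (i, d, z, false)) (Y (i, d, z, false))) ρ
        ((A ω).run (P.network (R.inst (X (i, d, z, false)) (Y (i, d, z, false))))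
      (P.view (R.inst (X (i, d, z, false)) (Y (i, d, z, false)))) t)} := by
    intro d i z h hgood
    rw [hmem] at h
    simp only [Set.mem_ofPred_eq, R.network_eq] at hgood
    refine absurd (R.lt_cost _ _ ?_ _ hgood.1) (not_lt.2 h)
    intro j
    by_cases hj : j = i
    · subst hj; simp [X, leftInput]
    · simp only [X, Y, leftInput, rightInput, Function.update_of_ne hj]
      cases d j <;> simp
  have hint : ∀ d i z, R.protocol (A ω) t (leftInput d i true z) (rightInput d i true z) ∈ accᶜ →
      ω ∉ {ω | P.IsApprox (R.inst (X (i, d, z, true)) (Y (i, d, z, true))) ρ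
        ((A ω).run (P.network (R.inst (X (i, d, z, true)) (Y (i, d, z, true))))
      (P.view (R.inst (X (i, d, z, true)) (Y (i, d, z, true)))) t)} := by
    intro d i z h hgood
    rw [Finset.mem_compl, hmem, not_le] at h
    simp only [Set.mem_ofPred_eq, R.network_eq] at hgood
    obtain ⟨o, ho, hle⟩ := R.exists_cost_le (X (i, d, z, true)) (Y (i, d, z, true)) i
      (by simp [X, leftInput]) (by simp [Y, rightInput])
    have h1 := hgood.2 o ho
    have h2 : ((r : ℝ) + 1) ≤ P.cost (R.inst (X (i, d, z, true)) (Y (i, d, z, true)))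
        (R.outputs (A ω) t (X (i, d, z, true)) (Y (i, d, z, true))) := by exact_mod_cast h
    have h3 : (P.cost (R.inst (X (i, d, z, true)) (Y (i, d, z, true))) o : ℝ) ≤ 2 := by
      exact_mod_cast hle
    have h4 : (0 : ℝ) ≤ P.cost (R.inst (X (i, d, z, true)) (Y (i, d, z, true))) o :=
      Nat.cast_nonneg _
    have h5 : (0 : ℝ) ≤ r := Nat.cast_nonneg _
    simp only [outputs] at h2
    -- A negative ratio would force a nonpositive cost, against `r + 1 > 0`.
    rcases le_total 0 ρ with h0 | h0 <;> nlinarith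
  have hcore := card_le_log_card_of_isRectangular (R.isRectangular_protocol (A ω) t) acc (by
    refine le_trans ?_ (hω.trans (le_of_eq ?_))
    · rw [Fintype.sum_prod_type]
      refine Finset.sum_le_sum fun i _ => ?_
      rw [Fintype.sum_prod_type]
      refine Finset.sum_le_sum fun d _ => ?_
      rw [Fintype.sum_prod_type, Finset.card_filter, Finset.card_filter]
      push_cast
      rw [← Finset.sum_add_distrib]
      refine Finset.sum_le_sum fun z _ => ?_
      rw [Fintype.sum_bool, add_comm]
      refine add_le_add ?_ ?_
      · split_ifs with h
        · rw [Set.indicator_of_mem (hint d i z h)]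
        · exact Set.indicator_nonneg (fun _ _ => zero_le_one) _
      · split_ifs with h
        · rw [Set.indicator_of_mem (hdisj d i z h)]
        · exact Set.indicator_nonneg (fun _ _ => zero_le_one) _
    · simp only [Fintype.card_prod, Fintype.card_bool]
      push_cast
      ring)
  rw [Fintype.card_fin] at hcore
  refine hcore.trans (mul_le_mul_of_nonneg_left ?_ (by norm_num))
  simp only [Fintype.card_prod, Fintype.card_fun, Fintype.card_fin, Fintype.card_option,
    Fintype.card_bool, Fintype.card_coe]
  push_cast
  rw [Real.log_mul (by positivity) (by positivity), Real.log_mul (by positivity) (by positivity),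
    Real.log_pow, Real.log_pow, Real.log_pow]
  have h1 : ((cutArcs R.graph R.side).card : ℝ) ≤ c := by exact_mod_cast R.card_cutArcs_le
  have h2 : (0 : ℝ) ≤ Real.log 3 := Real.log_nonneg (by norm_num)
  have h3 : (t : ℝ) * ((cutArcs R.graph R.side).card * (B * Real.log 3)) ≤
      t * (c * (B * Real.log 3)) := by gcongr
  norm_num at *
  nlinarith

end GapReduction

end Congest
namespace Congest

/-! ### Distances, connectivity and trees from rank functions. -/

section GraphTools

variable {V : Type} {G : SimpleGraph V}

theorem exists_edist_le_of_rank {D : Set V} (rank : V → ℕ)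
    (h : ∀ v, v ∈ D ∨ ∃ u, G.Adj v u ∧ rank u < rank v) (v : V) :
    ∃ s ∈ D, G.edist v s ≤ (rank v : ℕ∞) := by
  induction hr : rank v using Nat.strong_induction_on generalizing v with
  | _ m ih =>
    subst hr
    rcases h v with hv | ⟨u, huv, hlt⟩
    · exact ⟨v, hv, by simp⟩
    · obtain ⟨s, hs, hle⟩ := ih _ hlt u rfl
      refine ⟨s, hs, (SimpleGraph.edist_triangle (v := u)).trans ?_⟩
      rw [SimpleGraph.edist_eq_one_iff_adj.2 huv]
      calc (1 : ℕ∞) + G.edist u s ≤ 1 + (rank u : ℕ∞) := by gcongr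
        _ = ((1 + rank u : ℕ) : ℕ∞) := by push_cast; rfl
        _ ≤ (rank v : ℕ∞) := by exact_mod_cast (by omega : 1 + rank u ≤ rank v)

theorem connected_of_rank (r : V) (rank : V → ℕ)
    (h : ∀ v, v ≠ r → ∃ u, G.Adj v u ∧ rank u < rank v) : G.Connected := by
  have hr : ∀ v, G.Reachable v r := by
    intro v
    obtain ⟨s, hs, hle⟩ := exists_edist_le_of_rank (G := G) (D := {r}) rank
      (fun v => (eq_or_ne v r).imp id (h v)) v
    rw [Set.mem_singleton_iff] at hs
    subst hs
    exact SimpleGraph.reachable_of_edist_ne_top (ne_top_of_le_ne_top (ENat.natCast_ne_top _) hle)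
  have : Nonempty V := ⟨r⟩
  exact ⟨fun u v => (hr u).trans (hr v).symm⟩

/-- A function that grows by at most 1 along edges bounds distances from below. -/
theorem le_add_of_edist_le {φ : V → ℕ} (hφ : ∀ u v, G.Adj u v → φ v ≤ φ u + 1) {u v : V} {k : ℕ}
    (h : G.edist u v ≤ (k : ℕ∞)) : φ v ≤ φ u + k := by
  have hw : ∀ {a b : V} (p : G.Walk a b), φ b ≤ φ a + p.length := by
    intro a b p
    induction p with
    | nil => simp
    | cons hadj q ih =>
      have := hφ _ _ hadj
      rw [SimpleGraph.Walk.length_cons]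
      omega
  obtain ⟨p, hp⟩ := SimpleGraph.exists_walk_of_edist_ne_top
    (ne_top_of_le_ne_top (ENat.natCast_ne_top _) h)
  rw [← hp] at h
  have h1 := hw p
  have h2 : p.length ≤ k := by exact_mod_cast h
  omega

/-- Every edge joins its endpoint of larger rank to that vertex's only lower neighbour. So non-root
vertices map onto the edges, and a connected graph with that few edges is a tree. -/
theorem isTree_of_rank [Finite V] (r : V) (rank : V → ℕ) (hr : rank r = 0)
    (h : ∀ v, v ≠ r → ∃ u, G.Adj v u ∧ rank u < rank v)
    (huniq : ∀ v u u', G.Adj v u → G.Adj v u' → rank u < rank v → rank u' < rank v → u = u')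
    (hne : ∀ u v, G.Adj u v → rank u ≠ rank v) : G.IsTree := by
  have hconn := connected_of_rank r rank h
  refine SimpleGraph.isTree_iff_connected_and_card.2 ⟨hconn, le_antisymm ?_
    hconn.card_vert_le_card_edgeSet_add_one⟩
  choose par hpar using h
  let f : {v : V // v ≠ r} → G.edgeSet := fun v => ⟨s(v.1, par v.1 v.2), (hpar v.1 v.2).1⟩
  have hf : Function.Surjective f := by
    rintro ⟨e, he⟩
    induction e using Sym2.ind with
    | _ u v =>
      have hadj : G.Adj u v := he
      rcases lt_or_gt_of_ne (hne u v hadj) with hlt | hlt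
      · have hv : v ≠ r := by rintro rfl; omega
        refine ⟨⟨v, hv⟩, Subtype.ext ?_⟩
        have := huniq v _ _ (hpar v hv).1 hadj.symm (hpar v hv).2 hlt
        simp only [f, this]
        exact Sym2.eq_swap
      · have hu : u ≠ r := by rintro rfl; omega
        refine ⟨⟨u, hu⟩, Subtype.ext ?_⟩
        have := huniq u _ _ (hpar u hu).1 hadj (hpar u hu).2 hlt
        simp only [f, this]
  have hcard := Nat.card_le_card_of_surjective f hf
  have : Nat.card {v : V // v ≠ r} + 1 = Nat.card V := by
    classical
    have := Fintype.ofFinite V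
    have hpos : 0 < Fintype.card V := Fintype.card_pos_iff.2 ⟨r⟩
    simp only [Nat.card_eq_fintype_card, Fintype.card_subtype_compl, Fintype.card_subtype_eq]
    omega
  omega

/-- Keeping `u` reachable from `a` matters: if `u ≠ a`, some arc enters `u`, and its weight can be
charged. -/
theorem exists_step_of_reflTransGen {r : V → V → Prop} {S : Set V} {a b : V}
    (h : Relation.ReflTransGen r a b) (ha : a ∉ S) (hb : b ∈ S) :
    ∃ u v, Relation.ReflTransGen r a u ∧ r u v ∧ u ∉ S ∧ v ∈ S := by
  induction h with
  | refl => exact absurd hb ha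
  | @tail u v hau huv ih =>
    by_cases hu : u ∈ S
    · exact ih hu
    · exact ⟨u, v, hau, huv, hu, hb⟩

end GraphTools

/-! ### Weights split along a cut. -/

section Weight

variable {α : Type} [Fintype α]

/-- The part of the weight of a set that belongs to one side of a cut. -/
noncomputable def sideWeight (σ : α → Bool) (b : Bool) (w : α → ℕ) (s : Set α) : ℕ :=
  ∑ a ∈ Finset.univ.filter (fun a => σ a = b), s.indicator w a

/-- Each player may evaluate a part with weights `wl` or `wr` that involve only that player's input.
-/
theorem weight_eq_sideWeight_add (σ : α → Bool) (w wl wr : α → ℕ) (s : Set α)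
    (hl : ∀ a, σ a = true → w a = wl a) (hr : ∀ a, σ a = false → w a = wr a) :
    weight w s = sideWeight σ true wl s + sideWeight σ false wr s := by
  rw [weight, ← Finset.sum_filter_add_sum_filter_not Finset.univ (fun a => σ a = true), sideWeight,
    sideWeight]
  simp only [Bool.not_eq_true]
  classical
  refine congrArg₂ _ (Finset.sum_congr rfl fun a ha => ?_) (Finset.sum_congr rfl fun a ha => ?_)
  · rw [Set.indicator_apply, Set.indicator_apply, hl a (Finset.mem_filter.1 ha).2]
  · rw [Set.indicator_apply, Set.indicator_apply, hr a (Finset.mem_filter.1 ha).2]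

/-- Items of weight zero are exempt, since their membership may depend on the outputs of both sides.
-/
theorem sideWeight_congr (σ : α → Bool) (b : Bool) (w : α → ℕ) {s s' : Set α}
    (h : ∀ a, σ a = b → w a ≠ 0 → (a ∈ s ↔ a ∈ s')) : sideWeight σ b w s = sideWeight σ b w s' := by
  classical
  refine Finset.sum_congr rfl fun a ha => ?_
  rw [Set.indicator_apply, Set.indicator_apply]
  by_cases hw : w a = 0
  · simp [hw]
  · simp only [h a (Finset.mem_filter.1 ha).2 hw]

theorem sum_le_weight {γ : Type} (w : α → ℕ) (s : Set α) (C : Finset γ) (g : γ → α)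
    (hg : Function.Injective g) (hs : ∀ c ∈ C, g c ∈ s) : ∑ c ∈ C, w (g c) ≤ weight w s := by
  classical
  calc ∑ c ∈ C, w (g c) = ∑ c ∈ C, s.indicator w (g c) :=
        Finset.sum_congr rfl fun c hc => (Set.indicator_of_mem (hs c hc) _).symm
    _ = ∑ a ∈ C.image g, s.indicator w a := (Finset.sum_image fun _ _ _ _ h => hg h).symm
    _ ≤ _ := Finset.sum_le_sum_of_subset (Finset.subset_univ _)

theorem le_weight {w : α → ℕ} {s : Set α} {a : α} (ha : a ∈ s) : w a ≤ weight w s := by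
  have := sum_le_weight w s {a} id Function.injective_id (by simpa using ha)
  simpa using this

theorem weight_le_two {w : α → ℕ} {s : Set α} (a b : α) (ha : w a ≤ 1) (hb : w b ≤ 1)
    (h : ∀ c ∈ s, c ≠ a → c ≠ b → w c = 0) : weight w s ≤ 2 := by
  classical
  have h1 : weight w s ≤ ∑ c ∈ ({a, b} : Finset α), w c := by
    rw [weight, ← Finset.sum_subset (Finset.subset_univ ({a, b} : Finset α))]
    · exact Finset.sum_le_sum fun c _ => Set.indicator_le_self' (fun _ _ => Nat.zero_le _) c
    · intro c _ hc
      simp only [Finset.mem_insert, Finset.mem_singleton, not_or] at hc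
      rw [Set.indicator_apply]
      split_ifs with hcs
      · exact h c hcs hc.1 hc.2
      · rfl
  refine h1.trans ((Finset.sum_le_card_nsmul _ _ 1 ?_).trans ?_)
  · intro c hc
    rcases Finset.mem_insert.1 hc with rfl | hc
    · exact ha
    · rwa [Finset.mem_singleton.1 hc]
  · simpa using Finset.card_le_two

end Weight

/-! ### The network encoding set cover. -/

/-- The vertices of the network of the reduction: sets `S i` (`s = false`) and their complements
(`s = true`), for each side a hub and a dummy set, paths for the elements, and padding. On the path
of an element, `0` and `1` are adjacent to the sets on the two sides, and `2, …, k` is a path of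
which `2` is adjacent to `0` and `1`. -/
inductive GadgetVertex (T ℓ k m : ℕ)
  | set (s : Bool) (i : Fin T)
  | hub (s : Bool)
  | dummy (s : Bool)
  | elem (j : Fin ℓ) (p : Fin (k + 1))
  | pad (q : Fin m)
  deriving DecidableEq, Fintype

namespace GadgetVertex

variable {T ℓ k m : ℕ}

theorem card_eq : Fintype.card (GadgetVertex T ℓ k m) = 2 * T + 4 + ℓ * (k + 1) + m := by
  let e : GadgetVertex T ℓ k m ≃
      (Bool × Fin T) ⊕ Bool ⊕ Bool ⊕ (Fin ℓ × Fin (k + 1)) ⊕ Fin m :=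
    { toFun := fun
        | set s i => .inl (s, i)
        | hub s => .inr (.inl s)
        | dummy s => .inr (.inr (.inl s))
        | elem j p => .inr (.inr (.inr (.inl (j, p))))
        | pad q => .inr (.inr (.inr (.inr q)))
      invFun := fun
        | .inl (s, i) => set s i
        | .inr (.inl s) => hub s
        | .inr (.inr (.inl s)) => dummy s
        | .inr (.inr (.inr (.inl (j, p)))) => elem j p
        | .inr (.inr (.inr (.inr q))) => pad q
      left_inv := by rintro (_ | _ | _ | _ | _) <;> rfl
      right_inv := by rintro (_ | _ | _ | _ | _) <;> rfl }
  rw [Fintype.card_congr e]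
  simp
  ring

/-- The arcs of the network of the reduction, each in one direction. The matrix tells which sets
contain which elements. -/
inductive Link (M : Fin ℓ → Fin T → Bool) : GadgetVertex T ℓ k m → GadgetVertex T ℓ k m → Prop
  | hubs : Link M (hub false) (hub true)
  | set (s : Bool) (i : Fin T) : Link M (hub s) (set s i)
  | dummy (s : Bool) : Link M (hub s) (dummy s)
  | pad (q : Fin m) : Link M (hub false) (pad q)
  | cover (s : Bool) (i : Fin T) (j : Fin ℓ) (p : Fin (k + 1)) (hp : (p : ℕ) = s.toNat)
      (h : M j i = !s) : Link M (set s i) (elem j p)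
  | dummyCover (s : Bool) (j : Fin ℓ) (p : Fin (k + 1)) (hp : (p : ℕ) = s.toNat) :
      Link M (dummy s) (elem j p)
  | center (j : Fin ℓ) (p p' : Fin (k + 1)) (hp : (p : ℕ) ≤ 1) (hp' : (p' : ℕ) = 2) :
      Link M (elem j p) (elem j p')
  | tail (j : Fin ℓ) (p p' : Fin (k + 1)) (hp : 2 ≤ (p : ℕ)) (hp' : (p' : ℕ) = p + 1) :
      Link M (elem j p) (elem j p')

theorem Link.ne {M : Fin ℓ → Fin T → Bool} {u v : GadgetVertex T ℓ k m} (h : Link M u v) :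
    u ≠ v := by
  cases h <;> simp [Fin.ext_iff] <;> omega

/-- The network of the reduction. -/
def graph (M : Fin ℓ → Fin T → Bool) : SimpleGraph (GadgetVertex T ℓ k m) where
  Adj u v := Link M u v ∨ Link M v u
  symm := ⟨fun _ _ h => h.symm⟩
  loopless := ⟨fun _ h => h.elim (fun h => h.ne rfl) fun h => h.ne rfl⟩

/-- The player who simulates a vertex. -/
def side : GadgetVertex T ℓ k m → Bool
  | set s _ => !s
  | hub s => !s
  | dummy s => !s
  -- Only the vertex `1`, adjacent to the complements, lies on the right; so the edge from `1` to
  -- `2` is the only crossing edge of the path.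
  | elem _ p => (p : ℕ) != 1
  | pad _ => true

/-- Vertex weights: a set is cheap if its index belongs to the input of its player, and `e` is the
weight of the vertices on the paths of the elements. -/
def vertexWeight (n e : ℕ) (x y : Fin T → Bool) : GadgetVertex T ℓ k m → ℕ
  | set s i => if (if s then y i else x i) = true then 1 else n
  | hub _ => 0
  | dummy _ => n
  | elem _ _ => e
  | pad _ => 0

theorem vertexWeight_le {n e : ℕ} (hn : 1 ≤ n) (he : e ≤ n) (x y : Fin T → Bool)
    (v : GadgetVertex T ℓ k m) : vertexWeight n e x y v ≤ n := by
  cases v <;> simp only [vertexWeight] <;> (try split_ifs) <;> omega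

theorem vertexWeight_left (n e : ℕ) (x y y' : Fin T → Bool) (v : GadgetVertex T ℓ k m)
    (hv : side v = true) : vertexWeight n e x y v = vertexWeight n e x y' v := by
  cases v with
  | set s i => cases s <;> simp_all [side, vertexWeight]
  | _ => rfl

theorem vertexWeight_right (n e : ℕ) (x x' y : Fin T → Bool) (v : GadgetVertex T ℓ k m)
    (hv : side v = false) : vertexWeight n e x y v = vertexWeight n e x' y v := by
  cases v with
  | set s i => cases s <;> simp_all [side, vertexWeight]
  | _ => rfl

/-- The vertices of positive weight have all their neighbours on their own side. -/
theorem side_eq_of_adj {M : Fin ℓ → Fin T → Bool} {n : ℕ} {x y : Fin T → Bool}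
    {u v : GadgetVertex T ℓ k m} (h : (graph M).Adj u v) (hv : vertexWeight n 0 x y v ≠ 0) :
    side u = side v := by
  rcases h with h | h <;> cases h <;> simp_all [side, vertexWeight]

/-- A height function for which every vertex but the first hub has a lower neighbour. -/
def height : GadgetVertex T ℓ k m → ℕ
  | set _ _ => 2
  | hub s => s.toNat
  | dummy _ => 2
  | elem _ p => 3 + (p : ℕ)
  | pad _ => 1

theorem exists_height_lt (hk : 2 ≤ k) (M : Fin ℓ → Fin T → Bool) (v : GadgetVertex T ℓ k m)
    (hv : v ≠ hub false) : ∃ u, (graph M).Adj v u ∧ height u < height v := by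
  cases v with
  | set s i => exact ⟨hub s, Or.inr (.set s i), by cases s <;> simp [height]⟩
  | hub s =>
    cases s
    · exact absurd rfl hv
    · exact ⟨hub false, Or.inr .hubs, by simp [height]⟩
  | dummy s => exact ⟨hub s, Or.inr (.dummy s), by cases s <;> simp [height]⟩
  | pad q => exact ⟨hub false, Or.inr (.pad q), by simp [height]⟩
  | elem j p =>
    obtain ⟨p, hp⟩ := p
    rcases Nat.lt_or_ge p 3 with h | h
    · interval_cases p
      · exact ⟨dummy false, Or.inr (.dummyCover false j _ rfl), by simp [height]⟩
      · exact ⟨dummy true, Or.inr (.dummyCover true j _ rfl), by simp [height]⟩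
      · exact ⟨elem j ⟨0, by omega⟩, Or.inr (.center j _ _ (by simp) rfl), by simp [height]⟩
    · refine ⟨elem j ⟨p - 1, by omega⟩, Or.inr (.tail j _ _ ?_ ?_), ?_⟩ <;> simp [height] <;> omega

theorem connected_graph (hk : 2 ≤ k) (M : Fin ℓ → Fin T → Bool) :
    (graph M : SimpleGraph (GadgetVertex T ℓ k m)).Connected :=
  connected_of_rank (hub false) _ (exists_height_lt hk M)

/-- A collection of sets that covers all elements is expensive if the inputs are disjoint. -/
theorem lt_sum_of_covers {r n : ℕ} (hrn : r < n) {M : Fin ℓ → Fin T → Bool}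
    (hM : ∀ s : Finset (Fin T), s.card ≤ r → ∀ σ : Fin T → Bool, ∃ j, ∀ i ∈ s, M j i = σ i)
    {x y : Fin T → Bool} (hxy : ∀ i, ¬ (x i = true ∧ y i = true)) (C : Finset (Bool × Fin T))
    (hC : ∀ j, ∃ c ∈ C, M j c.2 = !c.1) :
    r < ∑ c ∈ C, if (if c.1 then y c.2 else x c.2) = true then 1 else n := by
  by_cases hcheap : ∀ c ∈ C, (if c.1 then y c.2 else x c.2) = true
  · rw [Finset.sum_congr rfl fun c hc => if_pos (hcheap c hc), Finset.sum_const, smul_eq_mul,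
      mul_one]
    by_contra hle
    -- The pattern `y` escapes every cheap choice: a chosen `S i` has `x i` true, so `y i = false`
    -- and `j` is outside it; a chosen complement has `y i = true`, so `j` lies in `S i`.
    obtain ⟨j, hj⟩ := hM (C.image Prod.snd) (Finset.card_image_le.trans (not_lt.1 hle)) y
    obtain ⟨⟨s, i⟩, hc, hcj⟩ := hC j
    have h1 := hj i (Finset.mem_image_of_mem Prod.snd hc)
    have h2 := hcheap _ hc
    have h3 := hxy i
    cases s <;> simp_all
  · push Not at hcheap
    obtain ⟨c, hc, hne⟩ := hcheap
    refine hrn.trans_le ?_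
    have := Finset.single_le_sum (f := fun c : Bool × Fin T =>
      if (if c.1 then y c.2 else x c.2) = true then 1 else n) (fun _ _ => Nat.zero_le _) hc
    simpa [hne] using this

/-- A set of items that contains, for each element, a covering set or a heavy item. -/
theorem lt_weight_of_covers {α : Type} [Fintype α] {r n : ℕ} (hrn : r < n)
    {M : Fin ℓ → Fin T → Bool}
    (hM : ∀ s : Finset (Fin T), s.card ≤ r → ∀ σ : Fin T → Bool, ∃ j, ∀ i ∈ s, M j i = σ i)
    {x y : Fin T → Bool} (hxy : ∀ i, ¬ (x i = true ∧ y i = true)) (w : α → ℕ) (s : Set α)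
    (g : Bool × Fin T → α) (hg : Function.Injective g)
    (hw : ∀ c, g c ∈ s → w (g c) = if (if c.1 then y c.2 else x c.2) = true then 1 else n)
    (h : ∀ j, (∃ a ∈ s, w a = n) ∨ ∃ c, g c ∈ s ∧ M j c.2 = !c.1) : r < weight w s := by
  classical
  by_cases hheavy : ∃ a ∈ s, w a = n
  · obtain ⟨a, ha, hwa⟩ := hheavy
    exact hrn.trans_le (hwa ▸ le_weight ha)
  · set C : Finset (Bool × Fin T) := Finset.univ.filter fun c => g c ∈ s with hC
    refine (lt_sum_of_covers hrn hM hxy C fun j => ?_).trans_le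
      ((le_of_eq ?_).trans (sum_le_weight w s C g hg fun c hc => (Finset.mem_filter.1 hc).2))
    · obtain ⟨c, hc, hj⟩ := (h j).resolve_left hheavy
      exact ⟨c, by simpa [hC] using hc, hj⟩
    · exact Finset.sum_congr rfl fun c hc => (hw c (Finset.mem_filter.1 hc).2).symm

/-- Only the edge between the hubs and one edge on each path cross; each counts in both directions.
-/
theorem card_cutArcs_le {n : ℕ} (e : GadgetVertex T ℓ k m ≃ Fin n) (hk : 2 ≤ k)
    (M : Fin ℓ → Fin T → Bool) :
    (cutArcs ((graph M).comap e.symm) (fun v => side (e.symm v))).card ≤ 2 * (ℓ + 1) := by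
  classical
  let a : Option (Fin ℓ) → GadgetVertex T ℓ k m × GadgetVertex T ℓ k m := fun
    | none => (hub false, hub true)
    | some j => (elem j ⟨1, by omega⟩, elem j ⟨2, by omega⟩)
  let F : Bool × Option (Fin ℓ) → Fin n × Fin n := fun c =>
    if c.1 then (e (a c.2).1, e (a c.2).2) else (e (a c.2).2, e (a c.2).1)
  have key : ∀ u v : GadgetVertex T ℓ k m, Link M u v → side u ≠ side v →
      ∃ o, a o = (u, v) := by
    intro u v h hne
    cases h with
    | hubs => exact ⟨none, rfl⟩
    | set s i => exact absurd rfl hne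
    | dummy s => exact absurd rfl hne
    | pad q => exact absurd rfl hne
    | cover s i j p hp h => exact absurd (by cases s <;> simp [side, hp]) hne
    | dummyCover s j p hp => exact absurd (by cases s <;> simp [side, hp]) hne
    | center j p p' hp hp' =>
      refine ⟨some j, ?_⟩
      have h1 : (p : ℕ) = 1 := by
        by_contra h0
        exact hne (by simp [side, hp', h0])
      simp only [a, Prod.mk.injEq, elem.injEq, true_and]
      exact ⟨Fin.ext h1.symm, Fin.ext hp'.symm⟩
    | tail j p p' hp hp' =>
      exact absurd (by simp only [side, hp', bne, beq_eq_decide]; congr 2; apply propext; omega) hne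
  have hsub : cutArcs ((graph M).comap e.symm) (fun v => side (e.symm v)) ⊆
      Finset.univ.image F := by
    rintro ⟨u, v⟩ huv
    simp only [cutArcs, Finset.mem_filter, Finset.mem_univ, true_and] at huv
    rcases huv.1 with h | h
    · obtain ⟨o, ho⟩ := key _ _ h huv.2
      exact Finset.mem_image.2 ⟨(true, o), Finset.mem_univ _, by simp [F, ho]⟩
    · obtain ⟨o, ho⟩ := key _ _ h huv.2.symm
      exact Finset.mem_image.2 ⟨(false, o), Finset.mem_univ _, by simp [F, ho]⟩
  refine (Finset.card_le_card hsub).trans (Finset.card_image_le.trans ?_)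
  simp

end GadgetVertex

end Congest
namespace Congest

namespace GadgetVertex

variable {T ℓ k m n r : ℕ}

/-! ### Weighted `k`-dominating sets. -/

theorem connected_comap (e : GadgetVertex T ℓ k m ≃ Fin n) (hk : 2 ≤ k)
    (M : Fin ℓ → Fin T → Bool) : ((graph M).comap e.symm).Connected :=
  (SimpleGraph.Iso.comap e.symm (graph M)).connected_iff.2 (connected_graph hk M)

/-- A lower bound on the distance from the end of the path of the element `j`. -/
def potential (M : Fin ℓ → Fin T → Bool) (j : Fin ℓ) : GadgetVertex T ℓ k m → ℕ
  | set s i => if M j i = !s then k else k + 1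
  | hub _ => k + 1
  | dummy _ => k
  | elem j' p => if j' = j then (if (p : ℕ) ≤ 1 then k - 1 else k - p) else k + 1
  | pad _ => k + 1

theorem potential_le_add_one (hk : 2 ≤ k) {M : Fin ℓ → Fin T → Bool} (j : Fin ℓ)
    {u v : GadgetVertex T ℓ k m} (h : (graph M).Adj u v) :
    potential M j v ≤ potential M j u + 1 := by
  have key : ∀ u v : GadgetVertex T ℓ k m, Link M u v →
      potential M j v ≤ potential M j u + 1 ∧ potential M j u ≤ potential M j v + 1 := by
    intro u v h
    cases h with
    | hubs => simp [potential]
    | set s i => simp only [potential]; split_ifs <;> omega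
    | dummy s => simp [potential]; omega
    | pad q => simp [potential]
    | cover s i j' p hp h =>
      have hp1 : (p : ℕ) ≤ 1 := by rw [hp]; cases s <;> simp
      simp only [potential, if_pos hp1]
      by_cases hj : j' = j
      · subst hj
        rw [if_pos h, if_pos rfl]
        omega
      · rw [if_neg hj]
        split_ifs <;> omega
    | dummyCover s j' p hp =>
      have hp1 : (p : ℕ) ≤ 1 := by rw [hp]; cases s <;> simp
      simp only [potential, if_pos hp1]
      split_ifs <;> omega
    | center j' p p' hp hp' =>
      simp only [potential, if_pos hp, hp']
      split_ifs <;> omega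
    | tail j' p p' hp hp' =>
      have := p'.2
      simp only [potential]
      split_ifs <;> omega
  exact h.elim (fun h => (key _ _ h).1) fun h => (key _ _ h).2

/-- The cheap dominating set for intersecting inputs. -/
def isDominator (i : Fin T) : GadgetVertex T ℓ k m → Bool
  | set _ i' => i' = i
  | hub _ => true
  | _ => false

/-- An upper bound on the distance to the cheap dominating set. -/
def dominationRank (M : Fin ℓ → Fin T → Bool) (i : Fin T) : GadgetVertex T ℓ k m → ℕ
  | set _ i' => if i' = i then 0 else 1
  | hub _ => 0
  | dummy _ => 1
  -- The covered one of `0` and `1` is next to a chosen set. The other is at distance 2 from a hub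
  -- through a dummy, which need not be chosen.
  | elem j p => if (p : ℕ) = 0 then (if M j i then 1 else 2) else
      if (p : ℕ) = 1 then (if M j i then 2 else 1) else p
  | pad _ => 1

theorem dominationRank_le (hk : 2 ≤ k) (M : Fin ℓ → Fin T → Bool) (i : Fin T)
    (v : GadgetVertex T ℓ k m) : dominationRank M i v ≤ k := by
  cases v with
  | elem j p =>
    have := p.2
    simp only [dominationRank]
    split_ifs <;> omega
  | _ => simp only [dominationRank]; (try split_ifs) <;> omega

theorem isDominator_or_exists_lt (hk : 2 ≤ k) (M : Fin ℓ → Fin T → Bool) (i : Fin T)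
    (v : GadgetVertex T ℓ k m) : isDominator i v = true ∨
      ∃ u, (graph M).Adj v u ∧ dominationRank M i u < dominationRank M i v := by
  cases v with
  | set s i' =>
    by_cases h : i' = i
    · exact Or.inl (by simp [isDominator, h])
    · exact Or.inr ⟨hub s, Or.inr (.set s i'), by simp [dominationRank, h]⟩
  | hub s => exact Or.inl rfl
  | dummy s => exact Or.inr ⟨hub s, Or.inr (.dummy s), by simp [dominationRank]⟩
  | pad q => exact Or.inr ⟨hub false, Or.inr (.pad q), by simp [dominationRank]⟩
  | elem j p =>
    right
    obtain ⟨p, hp⟩ := p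
    rcases Nat.lt_or_ge p 3 with h | h
    · interval_cases p
      · by_cases hM : M j i = true
        · exact ⟨set false i, Or.inr (.cover false i j _ rfl (by simp [hM])),
            by simp [dominationRank, hM]⟩
        · exact ⟨dummy false, Or.inr (.dummyCover false j _ rfl), by simp [dominationRank, hM]⟩
      · by_cases hM : M j i = true
        · exact ⟨dummy true, Or.inr (.dummyCover true j _ rfl), by simp [dominationRank, hM]⟩
        · exact ⟨set true i, Or.inr (.cover true i j _ rfl (by simpa using hM)),
            by simp [dominationRank, hM]⟩
      · by_cases hM : M j i = true
        · exact ⟨elem j ⟨0, by omega⟩, Or.inr (.center j _ _ (by simp) rfl),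
            by simp [dominationRank, hM]⟩
        · exact ⟨elem j ⟨1, by omega⟩, Or.inr (.center j _ _ (by simp) rfl),
            by simp [dominationRank, hM]⟩
    · refine ⟨elem j ⟨p - 1, by omega⟩, Or.inr (.tail j _ _ ?_ ?_), ?_⟩
      · simp; omega
      · simp; omega
      · simp only [dominationRank]
        split_ifs <;> omega

/-- The reduction for the minimum weight `k`-dominating set problem. -/
noncomputable def kMDSReduction (e : GadgetVertex T ℓ k m ≃ Fin n) (hk : 2 ≤ k) (hrn : r < n)
    (M : Fin ℓ → Fin T → Bool)
    (hM : ∀ s : Finset (Fin T), s.card ≤ r → ∀ σ : Fin T → Bool, ∃ j, ∀ i ∈ s, M j i = σ i) :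
    GapReduction (kMDS k n) T r (2 * (ℓ + 1)) where
  inst x y :=
    { graph := (graph M).comap e.symm
      connected := connected_comap e hk M
      w := fun v => vertexWeight n n x y (e.symm v)
      w_le := fun v => vertexWeight_le (by omega) le_rfl x y _ }
  graph := (graph M).comap e.symm
  network_eq _ _ := rfl
  side v := side (e.symm v)
  view_left x y y' v hv := by
    simp only [kMDS]
    rw [vertexWeight_left n n x y y' _ hv]
  view_right x x' y v hv := by
    simp only [kMDS]
    rw [vertexWeight_right n n x x' y _ hv]
  card_cutArcs_le := card_cutArcs_le e hk M
  costLeft x o := sideWeight (fun v => side (e.symm v)) true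
    (fun v => vertexWeight n n x (fun _ => false) (e.symm v)) {v | o v = true}
  costRight y o := sideWeight (fun v => side (e.symm v)) false
    (fun v => vertexWeight n n (fun _ => false) y (e.symm v)) {v | o v = true}
  cost_eq x y o := weight_eq_sideWeight_add (fun v => side (e.symm v))
    (fun v => vertexWeight n n x y (e.symm v)) _ _ {v | o v = true}
    (fun v hv => vertexWeight_left n n x y _ _ hv) fun v hv => vertexWeight_right n n x _ y _ hv
  costLeft_congr x o o' h := sideWeight_congr _ _ _ fun v hv _ => by
    simp only [Set.mem_ofPred_eq, h v hv]
  costRight_congr y o o' h := sideWeight_congr _ _ _ fun v hv _ => by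
    simp only [Set.mem_ofPred_eq, h v hv]
  lt_cost x y hxy o ho := by
    refine lt_weight_of_covers hrn hM hxy _ _ (fun c => e (set c.1 c.2)) ?_ ?_ ?_
    · rintro ⟨s, i⟩ ⟨s', i'⟩ h
      simpa using h
    · rintro ⟨s, i⟩ -
      simp [vertexWeight]
    · intro j
      -- The far end of the path of `j` lies beyond distance `k` from hubs, padding and sets not
      -- covering `j`; the dummies and path vertices have weight `n`.
      obtain ⟨v, hv, hd⟩ := ho (e (elem j (Fin.last k)))
      have h1 := le_add_of_edist_le (φ := fun v => potential M j (e.symm v))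
        (fun u v huv => potential_le_add_one hk j huv) hd
      obtain ⟨v, rfl⟩ := e.surjective v
      have h0 : potential M j (elem j (Fin.last k) : GadgetVertex T ℓ k m) = 0 := by
        simp [potential]
        omega
      simp only [Equiv.symm_apply_apply, h0, zero_add] at h1
      cases v with
      | set s i =>
        refine Or.inr ⟨(s, i), hv, ?_⟩
        by_contra hne
        simp only [potential, if_neg hne] at h1
        omega
      | hub s => simp [potential] at h1
      | pad q => simp [potential] at h1
      | dummy s => exact Or.inl ⟨_, hv, by simp [vertexWeight]⟩
      | elem j' p => exact Or.inl ⟨_, hv, by simp [vertexWeight]⟩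
  exists_cost_le x y i hx hy := by
    refine ⟨fun v => isDominator i (e.symm v), ?_, ?_⟩
    · intro v
      obtain ⟨s, hs, hle⟩ := exists_edist_le_of_rank (G := (graph M).comap e.symm)
        (D := {v | isDominator i (e.symm v) = true}) (fun v => dominationRank M i (e.symm v))
        (fun v => (isDominator_or_exists_lt hk M i (e.symm v)).imp id fun ⟨u, hu, hlt⟩ =>
          ⟨e u, by simpa using hu, by simpa using hlt⟩) v
      exact ⟨s, hs, hle.trans (by exact_mod_cast dominationRank_le hk M i _)⟩
    · refine weight_le_two (e (set false i)) (e (set true i)) (by simp [vertexWeight, hx])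
        (by simp [vertexWeight, hy]) ?_
      intro v hv h1 h2
      obtain ⟨v, rfl⟩ := e.surjective v
      simp only [Set.mem_ofPred_eq, Equiv.symm_apply_apply] at hv ⊢
      cases v with
      | set s i' =>
        simp only [isDominator, decide_eq_true_eq] at hv
        subst hv
        cases s <;> simp at h1 h2
      | hub s => rfl
      | _ => simp [isDominator] at hv

/-! ### Steiner trees, undirected and directed. -/

/-- The terminals of the Steiner tree instances. -/
def isTerminal : GadgetVertex T ℓ k m → Bool
  | hub _ => true
  | elem _ _ => true
  | _ => false

/-- The vertices of the cheap Steiner tree for intersecting inputs. -/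
def inTree (i : Fin T) : GadgetVertex T ℓ k m → Bool
  | hub _ => true
  | elem _ _ => true
  | set _ i' => i' = i
  | _ => false

/-- The parents in the cheap Steiner tree for intersecting inputs. -/
def parent (M : Fin ℓ → Fin T → Bool) (i : Fin T) : GadgetVertex T ℓ 2 m → GadgetVertex T ℓ 2 m
  | set s _ => hub s
  | elem j p =>
      -- The path of `j` hangs from whichever of `S i` and its complement covers `j`: the vertex
      -- next to that set, then the center `2`, then the remaining vertex.
      if p = 2 then elem j (if M j i then 0 else 1)
      else if p = (if M j i then 0 else 1) then set (!M j i) i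
      else elem j 2
  | _ => hub false

/-- The depths in the cheap Steiner tree for intersecting inputs. -/
def depth (M : Fin ℓ → Fin T → Bool) (i : Fin T) : GadgetVertex T ℓ 2 m → ℕ
  | set _ _ => 2
  | hub s => s.toNat
  | elem j p => if p = 2 then 4 else if p = (if M j i then 0 else 1) then 3 else 5
  | _ => 0

theorem inTree_of_isTerminal (i : Fin T) {v : GadgetVertex T ℓ k m} (h : isTerminal v = true) :
    inTree i v = true := by
  cases v <;> simp_all [isTerminal, inTree]

theorem parent_spec (M : Fin ℓ → Fin T → Bool) (i : Fin T) {v : GadgetVertex T ℓ 2 m}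
    (hv : inTree i v = true) (hne : v ≠ hub false) : (graph M).Adj v (parent M i v) ∧
      inTree i (parent M i v) = true ∧ depth M i (parent M i v) < depth M i v := by
  cases v with
  | set s i' => exact ⟨Or.inr (.set s i'), rfl, by cases s <;> simp [depth, parent]⟩
  | hub s =>
    cases s
    · exact absurd rfl hne
    · exact ⟨Or.inr .hubs, rfl, by simp [depth, parent]⟩
  | elem j p =>
    by_cases hM : M j i = true
    · fin_cases p
      · simp only [parent, hM, depth, inTree]
        exact ⟨Or.inr (.cover false i j _ rfl (by simp [hM])), by simp, by simp⟩
      · simp only [parent, hM, depth, inTree]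
        exact ⟨Or.inl (.center j _ _ (by simp) rfl), by simp, by simp⟩
      · simp only [parent, hM, depth, inTree]
        exact ⟨Or.inr (.center j _ _ (by simp) rfl), by simp, by simp [hM]⟩
    · rw [Bool.not_eq_true] at hM
      fin_cases p
      · simp only [parent, hM, depth, inTree]
        exact ⟨Or.inl (.center j _ _ (by simp) rfl), by simp, by simp⟩
      · simp only [parent, hM, depth, inTree]
        exact ⟨Or.inr (.cover true i j _ rfl (by simp [hM])), by simp, by simp⟩
      · simp only [parent, hM, depth, inTree]
        exact ⟨Or.inr (.center j _ _ (by simp) rfl), by simp, by simp [hM]⟩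
  | _ => simp [inTree] at hv

theorem vertexWeight_of_inTree {x y : Fin T → Bool} {i : Fin T}
    {v : GadgetVertex T ℓ k m} (hv : inTree i v = true) (h0 : v ≠ set false i)
    (h1 : v ≠ set true i) : vertexWeight n 0 x y v = 0 := by
  cases v with
  | set s i' =>
    simp only [inTree, decide_eq_true_eq] at hv
    subst hv
    cases s <;> simp at h0 h1
  | hub s => rfl
  | elem j p => rfl
  | _ => simp [inTree] at hv

/-- The path of `j` can be left only through a dummy or a set covering `j`; hence connecting it to a
hub pays for a cover or a heavy vertex. -/
theorem adj_elem {M : Fin ℓ → Fin T → Bool} {u : GadgetVertex T ℓ k m} {j : Fin ℓ}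
    {p : Fin (k + 1)} (h : (graph M).Adj u (elem j p)) :
    (∃ p', u = elem j p') ∨ (∃ s, u = dummy s) ∨ ∃ s i, u = set s i ∧ M j i = !s := by
  rcases h with h | h
  · cases h with
    | cover s i _ _ _ h => exact Or.inr (Or.inr ⟨s, i, rfl, h⟩)
    | dummyCover s => exact Or.inr (Or.inl ⟨s, rfl⟩)
    | center => exact Or.inl ⟨_, rfl⟩
    | tail => exact Or.inl ⟨_, rfl⟩
  · cases h with
    | center => exact Or.inl ⟨_, rfl⟩
    | tail => exact Or.inl ⟨_, rfl⟩

end GadgetVertex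

end Congest
namespace Congest

namespace GadgetVertex

variable {T ℓ m n r : ℕ}

/-- The instances of the node weighted Steiner tree problem in the reduction. -/
def steinerInstance (e : GadgetVertex T ℓ 2 m ≃ Fin n) (hn : 1 ≤ n) (M : Fin ℓ → Fin T → Bool)
    (x y : Fin T → Bool) : SteinerInstance n where
  graph := (graph M).comap e.symm
  connected := connected_comap e le_rfl M
  w := fun v => vertexWeight n 0 x y (e.symm v)
  w_le := fun v => vertexWeight_le hn (Nat.zero_le _) x y _
  terminals := {v | isTerminal (e.symm v) = true}
  terminals_nonempty := ⟨e (hub false), by simp [isTerminal]⟩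

/-- The vertices of the solution described by the outputs. -/
def steinerVerts (e : GadgetVertex T ℓ 2 m ≃ Fin n) (M : Fin ℓ → Fin T → Bool)
    (o : Fin n → Set (Fin n)) : Set (Fin n) :=
  {v | isTerminal (e.symm v) = true ∨
    ∃ u, (graph M).Adj (e.symm v) (e.symm u) ∧ (u ∈ o v ∨ v ∈ o u)}

/-- A vertex of positive weight has all its neighbours on its own side, so one player sees every
edge that could select it. -/
theorem mem_steinerVerts_congr {e : GadgetVertex T ℓ 2 m ≃ Fin n} {M : Fin ℓ → Fin T → Bool}
    {o o' : Fin n → Set (Fin n)} {b : Bool} (h : ∀ v, side (e.symm v) = b → o v = o' v)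
    {x y : Fin T → Bool} {v : Fin n} (hv : side (e.symm v) = b)
    (hw : vertexWeight n 0 x y (e.symm v) ≠ 0) :
    v ∈ steinerVerts e M o ↔ v ∈ steinerVerts e M o' := by
  refine or_congr Iff.rfl (exists_congr fun u => and_congr_right fun hadj => ?_)
  rw [h v hv, h u ((side_eq_of_adj hadj.symm hw).trans hv)]

theorem lt_weight_steinerVerts (e : GadgetVertex T ℓ 2 m ≃ Fin n) (hrn : r < n)
    {M : Fin ℓ → Fin T → Bool}
    (hM : ∀ s : Finset (Fin T), s.card ≤ r → ∀ σ : Fin T → Bool, ∃ j, ∀ i ∈ s, M j i = σ i)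
    {x y : Fin T → Bool} (hxy : ∀ i, ¬ (x i = true ∧ y i = true)) (o : Fin n → Set (Fin n))
    (ho : ((steinerInstance e (by omega) M x y).selected o).coe.Connected) :
    r < weight (fun v => vertexWeight n 0 x y (e.symm v)) (steinerVerts e M o) := by
  refine lt_weight_of_covers hrn hM hxy _ _ (fun c => e (set c.1 c.2)) ?_ ?_ ?_
  · rintro ⟨s, i⟩ ⟨s', i'⟩ h
    simpa using h
  · rintro ⟨s, i⟩ -
    simp [vertexWeight]
  · intro j
    set H := (steinerInstance e (by omega) M x y).selected o with hH
    have h0 : e (elem j 0) ∈ H.verts :=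
      Or.inl (show isTerminal (e.symm (e (elem j 0))) = true by simp [isTerminal])
    have h1 : e (hub false) ∈ H.verts :=
      Or.inl (show isTerminal (e.symm (e (hub false))) = true by simp [isTerminal])
    obtain ⟨p⟩ := ho.preconnected ⟨_, h0⟩ ⟨_, h1⟩
    obtain ⟨d, -, hd1, hd2⟩ := p.exists_boundary_dart {v | ∃ q, e.symm v.1 = elem j q}
      ⟨0, by simp⟩ (by simp)
    obtain ⟨q, hq⟩ := hd1
    have hadj : (graph M).Adj (e.symm d.snd.1) (elem j q) := by
      rw [← hq]
      have := d.adj.1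
      exact this.symm
    have hv : d.snd.1 ∈ steinerVerts e M o := d.snd.2
    rcases adj_elem hadj with h | ⟨s, hs⟩ | ⟨s, i, hs, hMi⟩
    · exact absurd h hd2
    · exact Or.inl ⟨_, hv, by simp [hs, vertexWeight]⟩
    · refine Or.inr ⟨(s, i), ?_, hMi⟩
      rw [e.symm_apply_eq] at hs
      rwa [hs] at hv

/-- The outputs that describe the cheap Steiner tree for intersecting inputs. -/
def treeOutput (e : GadgetVertex T ℓ 2 m ≃ Fin n) (M : Fin ℓ → Fin T → Bool) (i : Fin T)
    (v : Fin n) : Set (Fin n) :=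
  {u | inTree i (e.symm v) = true ∧ e.symm v ≠ hub false ∧ e.symm u = parent M i (e.symm v)}

theorem steinerVerts_treeOutput (e : GadgetVertex T ℓ 2 m ≃ Fin n) (M : Fin ℓ → Fin T → Bool)
    (i : Fin T) (v : Fin n) : v ∈ steinerVerts e M (treeOutput e M i) ↔
      inTree i (e.symm v) = true := by
  constructor
  · rintro (h | ⟨u, -, h | h⟩)
    · exact inTree_of_isTerminal i h
    · exact h.1
    · rw [h.2.2]
      exact (parent_spec M i h.1 h.2.1).2.1
  · intro h
    by_cases h0 : e.symm v = hub false
    · exact Or.inl (by simp [h0, isTerminal])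
    · refine Or.inr ⟨e (parent M i (e.symm v)), ?_, Or.inl ⟨h, h0, by simp⟩⟩
      simpa using (parent_spec M i h h0).1

theorem isTree_selected_treeOutput (e : GadgetVertex T ℓ 2 m ≃ Fin n) (hn : 1 ≤ n)
    (M : Fin ℓ → Fin T → Bool) (x y : Fin T → Bool) (i : Fin T) :
    ((steinerInstance e hn M x y).selected (treeOutput e M i)).coe.IsTree := by
  set H := (steinerInstance e hn M x y).selected (treeOutput e M i) with hH
  have hverts : ∀ v, v ∈ H.verts ↔ inTree i (e.symm v) = true := fun v =>
    steinerVerts_treeOutput e M i v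
  have hadj : ∀ u v : Fin n, H.Adj u v ↔ (graph M).Adj (e.symm u) (e.symm v) ∧
      (v ∈ treeOutput e M i u ∨ u ∈ treeOutput e M i v) := fun u v => Iff.rfl
  have hlt : ∀ u v : Fin n, u ∈ treeOutput e M i v →
      depth M i (e.symm u) < depth M i (e.symm v) := fun u v h => by
    rw [h.2.2]
    exact (parent_spec M i h.1 h.2.1).2.2
  have hroot : e (hub false) ∈ H.verts := (hverts _).2 (by simp [inTree])
  refine isTree_of_rank ⟨e (hub false), hroot⟩ (fun v => depth M i (e.symm v.1))
    (by simp [depth]) ?_ ?_ ?_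
  · rintro ⟨v, hv⟩ hne
    have h0 : e.symm v ≠ hub false := fun h => hne (Subtype.ext (e.symm_apply_eq.1 h))
    obtain ⟨h1, h2, h3⟩ := parent_spec M i ((hverts v).1 hv) h0
    refine ⟨⟨e (parent M i (e.symm v)), (hverts _).2 (by simpa using h2)⟩, ?_, by simpa using h3⟩
    rw [SimpleGraph.Subgraph.coe_adj, hadj]
    exact ⟨by simpa using h1, Or.inl ⟨(hverts v).1 hv, h0, by simp⟩⟩
  · rintro ⟨v, hv⟩ ⟨u, hu⟩ ⟨u', hu'⟩ h h' hl hl'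
    rw [SimpleGraph.Subgraph.coe_adj, hadj] at h h'
    have h1 : u ∈ treeOutput e M i v := h.2.resolve_right fun hc => by
      have := hlt _ _ hc
      exact absurd hl this.not_gt
    have h2 : u' ∈ treeOutput e M i v := h'.2.resolve_right fun hc => by
      have := hlt _ _ hc
      exact absurd hl' this.not_gt
    exact Subtype.ext (e.symm.injective (h1.2.2.trans h2.2.2.symm))
  · rintro ⟨u, hu⟩ ⟨v, hv⟩ h
    rw [SimpleGraph.Subgraph.coe_adj, hadj] at h
    rcases h.2 with h | h
    · exact (hlt _ _ h).ne'
    · exact (hlt _ _ h).ne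

/-- The reduction for the node weighted Steiner tree problem. -/
noncomputable def nodeSteinerReduction (e : GadgetVertex T ℓ 2 m ≃ Fin n) (hrn : r < n)
    (M : Fin ℓ → Fin T → Bool)
    (hM : ∀ s : Finset (Fin T), s.card ≤ r → ∀ σ : Fin T → Bool, ∃ j, ∀ i ∈ s, M j i = σ i) :
    GapReduction (nodeSteiner n) T r (2 * (ℓ + 1)) where
  inst x y := steinerInstance e (by omega) M x y
  graph := (graph M).comap e.symm
  network_eq _ _ := rfl
  side v := side (e.symm v)
  view_left x y y' v hv := by
    simp only [nodeSteiner, steinerInstance]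
    rw [vertexWeight_left n 0 x y y' _ hv]
  view_right x x' y v hv := by
    simp only [nodeSteiner, steinerInstance]
    rw [vertexWeight_right n 0 x x' y _ hv]
  card_cutArcs_le := card_cutArcs_le e le_rfl M
  costLeft x o := sideWeight (fun v => side (e.symm v)) true
    (fun v => vertexWeight n 0 x (fun _ => false) (e.symm v)) (steinerVerts e M o)
  costRight y o := sideWeight (fun v => side (e.symm v)) false
    (fun v => vertexWeight n 0 (fun _ => false) y (e.symm v)) (steinerVerts e M o)
  cost_eq x y o := weight_eq_sideWeight_add (fun v => side (e.symm v))
    (fun v => vertexWeight n 0 x y (e.symm v)) _ _ (steinerVerts e M o)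
    (fun v hv => vertexWeight_left n 0 x y _ _ hv) fun v hv => vertexWeight_right n 0 x _ y _ hv
  costLeft_congr _ _ _ h := sideWeight_congr _ _ _ fun _ hv hw => mem_steinerVerts_congr h hv hw
  costRight_congr _ _ _ h := sideWeight_congr _ _ _ fun _ hv hw => mem_steinerVerts_congr h hv hw
  lt_cost _ _ hxy o ho := lt_weight_steinerVerts e hrn hM hxy o ho.1.connected
  exists_cost_le x y i hx hy := by
    refine ⟨treeOutput e M i, ⟨isTree_selected_treeOutput e _ M x y i, fun v hv => Or.inl hv⟩, ?_⟩
    refine weight_le_two (e (set false i)) (e (set true i))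
        (by simp [steinerInstance, vertexWeight, hx])
        (by simp [steinerInstance, vertexWeight, hy]) ?_
    intro v hv h1 h2
    exact vertexWeight_of_inTree ((steinerVerts_treeOutput e M i v).1 hv)
      (fun h => h1 (e.symm_apply_eq.1 h)) fun h => h2 (e.symm_apply_eq.1 h)

/-- The arcs of the symmetric digraph of the reduction that the outputs select. -/
def selectedArcs (e : GadgetVertex T ℓ 2 m ≃ Fin n) (M : Fin ℓ → Fin T → Bool)
    (o : Fin n → Set (Fin n × Fin n)) : Set (Fin n × Fin n) :=
  {a | (graph M).Adj (e.symm a.1) (e.symm a.2) ∧ (a ∈ o a.1 ∨ a ∈ o a.2)}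

theorem toSimpleGraphInclusive_adj {V : Type} (G : SimpleGraph V) :
    (⟨G.Adj⟩ : Digraph V).toSimpleGraphInclusive = G := by
  ext u v
  simp only [Digraph.toSimpleGraphInclusive, SimpleGraph.fromRel_adj]
  constructor
  · rintro ⟨-, h | h⟩
    exacts [h, h.symm]
  · exact fun h => ⟨h.ne, Or.inl h⟩

/-- The instances of the directed Steiner tree problem in the reduction: an arc has the weight of
its head. -/
def directedSteinerInstance (e : GadgetVertex T ℓ 2 m ≃ Fin n) (hn : 1 ≤ n)
    (M : Fin ℓ → Fin T → Bool) (x y : Fin T → Bool) : DirectedSteinerInstance n where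
  digraph := ⟨((graph M).comap e.symm).Adj⟩
  loopless v h := SimpleGraph.irrefl ((graph M).comap e.symm) h
  connected := by
    rw [toSimpleGraphInclusive_adj]
    exact connected_comap e le_rfl M
  w a := vertexWeight n 0 x y (e.symm a.2)
  w_le a := vertexWeight_le hn (Nat.zero_le _) x y _
  root := e (hub false)
  terminals := {v | isTerminal (e.symm v) = true}
  reachable v _ := by
    have := (connected_comap e le_rfl M).preconnected (e (hub false)) v
    rwa [SimpleGraph.reachable_iff_reflTransGen] at this

/-- An arc carries the weight of its head, which may belong to the other player; but heads of
crossing arcs have weight zero. -/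
theorem vertexWeight_left_of_adj {M : Fin ℓ → Fin T → Bool} (x y y' : Fin T → Bool)
    {u v : GadgetVertex T ℓ 2 m} (h : (graph M).Adj u v) (hu : side u = true) :
    vertexWeight n 0 x y v = vertexWeight n 0 x y' v := by
  by_cases hv : side v = true
  · exact vertexWeight_left n 0 x y y' v hv
  · have h0 : ∀ y, vertexWeight n 0 x y v = 0 := fun y => by
      by_contra hne
      exact hv ((side_eq_of_adj h hne).symm.trans hu)
    rw [h0, h0]

theorem vertexWeight_right_of_adj {M : Fin ℓ → Fin T → Bool} (x x' y : Fin T → Bool)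
    {u v : GadgetVertex T ℓ 2 m} (h : (graph M).Adj u v) (hu : side u = false) :
    vertexWeight n 0 x y v = vertexWeight n 0 x' y v := by
  by_cases hv : side v = false
  · exact vertexWeight_right n 0 x x' y v hv
  · have h0 : ∀ x, vertexWeight n 0 x y v = 0 := fun x => by
      by_contra hne
      exact hv ((side_eq_of_adj h hne).symm.trans hu)
    rw [h0, h0]

theorem mem_selectedArcs_congr {e : GadgetVertex T ℓ 2 m ≃ Fin n} {M : Fin ℓ → Fin T → Bool}
    {o o' : Fin n → Set (Fin n × Fin n)} {b : Bool} (h : ∀ v, side (e.symm v) = b → o v = o' v)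
    {x y : Fin T → Bool} {a : Fin n × Fin n} (ha : side (e.symm a.2) = b)
    (hw : vertexWeight n 0 x y (e.symm a.2) ≠ 0) :
    a ∈ selectedArcs e M o ↔ a ∈ selectedArcs e M o' := by
  refine and_congr_right fun hadj => ?_
  rw [h a.2 ha, h a.1 ((side_eq_of_adj hadj hw).trans ha)]

theorem lt_weight_selectedArcs (e : GadgetVertex T ℓ 2 m ≃ Fin n) (hrn : r < n)
    {M : Fin ℓ → Fin T → Bool}
    (hM : ∀ s : Finset (Fin T), s.card ≤ r → ∀ σ : Fin T → Bool, ∃ j, ∀ i ∈ s, M j i = σ i)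
    {x y : Fin T → Bool} (hxy : ∀ i, ¬ (x i = true ∧ y i = true))
    (o : Fin n → Set (Fin n × Fin n))
    (ho : ∀ v, isTerminal (e.symm v) = true →
      Relation.ReflTransGen (fun a b => (a, b) ∈ selectedArcs e M o) (e (hub false)) v) :
    r < weight (fun a => vertexWeight n 0 x y (e.symm a.2)) (selectedArcs e M o) := by
  classical
  -- One selected entering arc stands for each set vertex. The default is used only if no such arc
  -- exists, and then it is not selected either.
  let g : Bool × Fin T → Fin n × Fin n := fun c =>
    (if h : ∃ u, (u, e (set c.1 c.2)) ∈ selectedArcs e M o then h.choose else e (hub false),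
      e (set c.1 c.2))
  have hg : ∀ s i u, (u, e (set s i)) ∈ selectedArcs e M o → g (s, i) ∈ selectedArcs e M o := by
    intro s i u hu
    have h : ∃ u, (u, e (set s i)) ∈ selectedArcs e M o := ⟨u, hu⟩
    simp only [g, dif_pos h]
    exact h.choose_spec
  refine lt_weight_of_covers hrn hM hxy _ _ g ?_ ?_ ?_
  · rintro ⟨s, i⟩ ⟨s', i'⟩ h
    have := congrArg Prod.snd h
    simpa [g] using this
  · rintro ⟨s, i⟩ -
    simp [g, vertexWeight]
  · intro j
    obtain ⟨u, v, hu, huv, hnu, q, hq⟩ := exists_step_of_reflTransGen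
      (S := {v | ∃ q, e.symm v = elem j q}) (ho (e (elem j 0)) (by simp [isTerminal]))
      (by simp) ⟨0, by simp⟩
    have hadj : (graph M).Adj (e.symm u) (elem j q) := hq ▸ huv.1
    -- The vertex before the entry into the path of `j` is reached by a selected arc unless it is
    -- the root; that arc bears the cost of the dummy or set.
    have hin : u ≠ e (hub false) → ∃ w, (w, u) ∈ selectedArcs e M o := by
      intro hne
      rcases Relation.ReflTransGen.cases_tail hu with h | ⟨w, -, hw⟩
      · exact absurd h hne
      · exact ⟨w, hw⟩
    rcases adj_elem hadj with h | ⟨s, hs⟩ | ⟨s, i, hs, hMi⟩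
    · exact absurd h hnu
    · obtain ⟨w, hw⟩ := hin (by rintro rfl; simp at hs)
      exact Or.inl ⟨_, hw, by simp [hs, vertexWeight]⟩
    · obtain ⟨w, hw⟩ := hin (by rintro rfl; simp at hs)
      rw [e.symm_apply_eq.1 hs] at hw
      exact Or.inr ⟨(s, i), hg s i w hw, hMi⟩

/-- The outputs that describe the cheap directed Steiner tree for intersecting inputs. -/
def treeArcs (e : GadgetVertex T ℓ 2 m ≃ Fin n) (M : Fin ℓ → Fin T → Bool) (i : Fin T)
    (v : Fin n) : Set (Fin n × Fin n) :=
  {a | a.2 = v ∧ a.1 ∈ treeOutput e M i v}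

theorem mem_selectedArcs_treeArcs (e : GadgetVertex T ℓ 2 m ≃ Fin n) (M : Fin ℓ → Fin T → Bool)
    (i : Fin T) (u v : Fin n) :
    (u, v) ∈ selectedArcs e M (treeArcs e M i) ↔ u ∈ treeOutput e M i v := by
  constructor
  · rintro ⟨hadj, ⟨h, -⟩ | h⟩
    · simp only at h hadj
      rw [h] at hadj
      exact absurd rfl hadj.ne
    · exact h.2
  · intro h
    refine ⟨?_, Or.inr ⟨rfl, h⟩⟩
    have := (parent_spec M i h.1 h.2.1).1
    rw [← h.2.2] at this
    exact this.symm

theorem reflTransGen_treeArcs (e : GadgetVertex T ℓ 2 m ≃ Fin n) (M : Fin ℓ → Fin T → Bool)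
    (i : Fin T) (v : Fin n) (hv : inTree i (e.symm v) = true) :
    Relation.ReflTransGen (fun a b => (a, b) ∈ selectedArcs e M (treeArcs e M i))
      (e (hub false)) v := by
  induction hd : depth M i (e.symm v) using Nat.strong_induction_on generalizing v with
  | _ d ih =>
    subst hd
    by_cases h0 : e.symm v = hub false
    · rw [e.symm_apply_eq.1 h0]
    · obtain ⟨-, h2, h3⟩ := parent_spec M i hv h0
      refine (ih _ h3 (e (parent M i (e.symm v))) (by simpa using h2) (by simp)).tail ?_
      rw [mem_selectedArcs_treeArcs]
      exact ⟨hv, h0, by simp⟩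

/-- The reduction for the directed Steiner tree problem. -/
noncomputable def directedSteinerReduction (e : GadgetVertex T ℓ 2 m ≃ Fin n) (hrn : r < n)
    (M : Fin ℓ → Fin T → Bool)
    (hM : ∀ s : Finset (Fin T), s.card ≤ r → ∀ σ : Fin T → Bool, ∃ j, ∀ i ∈ s, M j i = σ i) :
    GapReduction (directedSteiner n) T r (2 * (ℓ + 1)) where
  inst x y := directedSteinerInstance e (by omega) M x y
  graph := (graph M).comap e.symm
  network_eq _ _ := toSimpleGraphInclusive_adj _
  side v := side (e.symm v)
  view_left x y y' v hv := by
    simp only [directedSteiner, directedSteinerInstance, DirectedSteinerView.mk.injEq, and_true]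
    refine ⟨funext fun u => ?_, funext fun u => ?_⟩
    · split_ifs with h
      · rw [vertexWeight_left_of_adj x y y' h hv]
      · rfl
    · rw [vertexWeight_left n 0 x y y' _ hv]
  view_right x x' y v hv := by
    simp only [directedSteiner, directedSteinerInstance, DirectedSteinerView.mk.injEq, and_true]
    refine ⟨funext fun u => ?_, funext fun u => ?_⟩
    · split_ifs with h
      · rw [vertexWeight_right_of_adj x x' y h hv]
      · rfl
    · rw [vertexWeight_right n 0 x x' y _ hv]
  card_cutArcs_le := card_cutArcs_le e le_rfl M
  costLeft x o := sideWeight (fun a : Fin n × Fin n => side (e.symm a.2)) true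
    (fun a => vertexWeight n 0 x (fun _ => false) (e.symm a.2)) (selectedArcs e M o)
  costRight y o := sideWeight (fun a : Fin n × Fin n => side (e.symm a.2)) false
    (fun a => vertexWeight n 0 (fun _ => false) y (e.symm a.2)) (selectedArcs e M o)
  cost_eq x y o := weight_eq_sideWeight_add (fun a : Fin n × Fin n => side (e.symm a.2))
    (fun a => vertexWeight n 0 x y (e.symm a.2)) _ _ (selectedArcs e M o)
    (fun a ha => vertexWeight_left n 0 x y _ _ ha) fun a ha => vertexWeight_right n 0 x _ y _ ha
  costLeft_congr _ _ _ h := sideWeight_congr _ _ _ fun _ hv hw => mem_selectedArcs_congr h hv hw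
  costRight_congr _ _ _ h := sideWeight_congr _ _ _ fun _ hv hw => mem_selectedArcs_congr h hv hw
  lt_cost _ _ hxy o ho := lt_weight_selectedArcs e hrn hM hxy o ho.2
  exists_cost_le x y i hx hy := by
    refine ⟨treeArcs e M i, ⟨⟨?_, ?_, ?_⟩, ?_⟩, ?_⟩
    · intro u hu
      exact ((mem_selectedArcs_treeArcs e M i u _).1 hu).2.1 (by simp [directedSteinerInstance])
    · intro u u' v h h'
      have h1 := (mem_selectedArcs_treeArcs e M i u v).1 h
      have h2 := (mem_selectedArcs_treeArcs e M i u' v).1 h'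
      exact e.symm.injective (h1.2.2.trans h2.2.2.symm)
    · intro u v h
      have h1 := (mem_selectedArcs_treeArcs e M i u v).1 h
      refine reflTransGen_treeArcs e M i u ?_
      rw [h1.2.2]
      exact (parent_spec M i h1.1 h1.2.1).2.1
    · intro v hv
      exact reflTransGen_treeArcs e M i v (inTree_of_isTerminal i hv)
    · refine weight_le_two (e (hub false), e (set false i)) (e (hub true), e (set true i))
        (by simp [directedSteinerInstance, vertexWeight, hx])
        (by simp [directedSteinerInstance, vertexWeight, hy]) ?_
      rintro ⟨u, v⟩ h h1 h2
      have h3 := (mem_selectedArcs_treeArcs e M i u v).1 h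
      refine vertexWeight_of_inTree h3.1 (fun h4 => h1 ?_) fun h4 => h2 ?_
      · have h5 := h3.2.2
        rw [h4] at h5
        exact Prod.ext (e.symm_apply_eq.1 h5) (e.symm_apply_eq.1 h4)
      · have h5 := h3.2.2
        rw [h4] at h5
        exact Prod.ext (e.symm_apply_eq.1 h5) (e.symm_apply_eq.1 h4)

end GadgetVertex

end Congest
namespace Congest

/-! ### Choice of parameters and asymptotics. -/

open Filter

theorem eventually_const_mul_log_pow_le (C : ℝ) (p : ℕ) {s : ℝ} (hs : 0 < s) :
    ∀ᶠ n : ℕ in atTop, C * Real.log n ^ p ≤ (n : ℝ) ^ s := by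
  have h := (isLittleO_log_rpow_rpow_atTop (p : ℝ) hs).comp_tendsto tendsto_natCast_atTop_atTop
  have h1 := h.def (c := (|C| + 1)⁻¹) (by positivity)
  filter_upwards [h1, eventually_ge_atTop 1] with n hn hn1
  have hlog : 0 ≤ Real.log n := Real.log_natCast_nonneg n
  simp only [Function.comp_apply, Real.rpow_natCast, norm_pow, Real.norm_eq_abs, abs_of_nonneg hlog]
    at hn
  have hpos : (0 : ℝ) ≤ (n : ℝ) ^ s := by positivity
  rw [abs_of_nonneg hpos, ← div_eq_inv_mul, le_div_iff₀ (by positivity)] at hn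
  refine le_trans ?_ hn
  rw [mul_comm]
  exact mul_le_mul_of_nonneg_left (by linarith [le_abs_self C]) (by positivity)

theorem two_pow_le_exp (r : ℕ) : (2 : ℝ) ^ r ≤ Real.exp r := by
  have h : (2 : ℝ) ≤ Real.exp 1 := by linarith [Real.add_one_le_exp (1 : ℝ)]
  calc (2 : ℝ) ^ r ≤ Real.exp 1 ^ r := by gcongr
    _ = Real.exp r := by rw [← Real.exp_nat_mul, mul_one]

theorem clog_two_le {n : ℕ} (h : 1 ≤ Real.log n) : (Nat.clog 2 n : ℝ) ≤ 3 * Real.log n := by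
  have hn : 2 ≤ n := by
    by_contra hlt
    interval_cases n <;> norm_num at h
  have h1 : Nat.clog 2 n ≤ Nat.log 2 n + 1 :=
    Nat.clog_le_of_le_pow (Nat.lt_pow_succ_log_self (by norm_num) n).le
  have h2 : (2 : ℝ) ^ Nat.log 2 n ≤ n := by exact_mod_cast Nat.pow_log_le_self 2 (by omega)
  have h3 : (Nat.log 2 n : ℝ) * Real.log 2 ≤ Real.log n := by
    rw [← Real.log_pow]
    exact Real.log_le_log (by positivity) h2
  have h4 : (Nat.clog 2 n : ℝ) ≤ Nat.log 2 n + 1 := by exact_mod_cast h1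
  have h5 := Real.log_two_gt_d9
  nlinarith [(Nat.cast_nonneg (Nat.log 2 n) : (0 : ℝ) ≤ _)]

/-- The networks of the reduction give instances of the problem. -/
def HasGapReductions (P : ∀ n : ℕ, MinProblem n) (k : ℕ) : Prop :=
  ∀ (T ℓ m n r : ℕ) (_ : GadgetVertex T ℓ k m ≃ Fin n) (_ : r < n) (M : Fin ℓ → Fin T → Bool),
    (∀ s : Finset (Fin T), s.card ≤ r → ∀ σ : Fin T → Bool, ∃ j, ∀ i ∈ s, M j i = σ i) →
    Nonempty (GapReduction (P n) T r (2 * (ℓ + 1)))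

/-- A network with `n` vertices, of which a constant fraction encodes the inputs. -/
theorem HasGapReductions.exists_gapReduction {P : ∀ n : ℕ, MinProblem n} {k : ℕ}
    (hP : HasGapReductions P k) {n r : ℕ} (hr : (4 : ℝ) ^ r ≤ n) (hlog : 1 ≤ Real.log n)
    (hn : 8 * (k + 1) * Real.log n ^ 2 ≤ (n : ℝ) ^ (1 / 2 : ℝ)) (hn' : Real.log n + 16 ≤ n) :
    ∃ T ℓ : ℕ, (n : ℝ) / 4 - 1 ≤ T ∧ (ℓ : ℝ) ≤ 2 * (2 ^ r * Real.log n ^ 2) ∧ (r : ℝ) ≤ Real.log n ∧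
      Nonempty (GapReduction (P n) T r (2 * (ℓ + 1))) := by
  set L := Real.log n with hL
  have hn0 : (0 : ℝ) < n := by linarith
  have hrL : (r : ℝ) ≤ L := by
    have h1 : (r : ℝ) * Real.log 4 ≤ L := by
      rw [← Real.log_pow]
      exact Real.log_le_log (by positivity) hr
    have h2 : (1 : ℝ) ≤ Real.log 4 := by
      rw [show (4 : ℝ) = 2 ^ 2 by norm_num, Real.log_pow]
      have := Real.log_two_gt_d9
      push_cast
      linarith
    nlinarith [(Nat.cast_nonneg r : (0 : ℝ) ≤ r)]
  have hsq : (2 : ℝ) ^ r ≤ (n : ℝ) ^ (1 / 2 : ℝ) := by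
    rw [← Real.sqrt_eq_rpow]
    refine Real.le_sqrt_of_sq_le ?_
    rw [← pow_mul, mul_comm, pow_mul]
    norm_num
    exact hr
  have hhalf : (n : ℝ) ^ (1 / 2 : ℝ) * (n : ℝ) ^ (1 / 2 : ℝ) = n := by
    rw [← Real.rpow_add hn0]
    norm_num
  set T := n / 4 with hT
  have hTlow : (n : ℝ) / 4 - 1 ≤ T := by
    have : n ≤ 4 * T + 4 := by omega
    have h1 : (n : ℝ) ≤ 4 * T + 4 := by exact_mod_cast this
    linarith
  have hT4 : (4 : ℝ) * T ≤ n := by exact_mod_cast (by omega : 4 * T ≤ n)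
  have hlogT : Real.log (2 * T) ≤ L := by
    rcases Nat.eq_zero_or_pos T with h0 | h0
    · rw [h0]
      simp
      linarith
    · have : (0 : ℝ) < T := by exact_mod_cast h0
      exact Real.log_le_log (by positivity) (by linarith)
  have hbound : (2 : ℝ) ^ r * (r * Real.log (2 * T)) ≤ 2 ^ r * L ^ 2 := by
    refine mul_le_mul_of_nonneg_left ?_ (by positivity)
    nlinarith [(Nat.cast_nonneg r : (0 : ℝ) ≤ r)]
  -- From `4 ^ r ≤ n` come `r ≤ L`, so these rows suffice for a universal matrix, and `2 ^ r ≤ √n`,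
  -- so the paths fill at most a quarter of the network.
  set ℓ := ⌊(2 : ℝ) ^ r * L ^ 2⌋₊ + 1 with hℓ
  have hℓ1 : (2 : ℝ) ^ r * L ^ 2 < ℓ := by
    rw [hℓ]
    push_cast
    exact Nat.lt_floor_add_one _
  have hpow : (1 : ℝ) ≤ 2 ^ r := one_le_pow₀ (by norm_num)
  have hℓ2 : (ℓ : ℝ) ≤ 2 * (2 ^ r * L ^ 2) := by
    have h1 := Nat.floor_le (show (0 : ℝ) ≤ 2 ^ r * L ^ 2 by positivity)
    have h2 : (1 : ℝ) ≤ 2 ^ r * L ^ 2 := one_le_mul_of_one_le_of_one_le hpow (one_le_pow₀ hlog)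
    rw [hℓ]
    push_cast
    linarith
  obtain ⟨M, hM⟩ := exists_universal_matrix (T := T) (r := r) (ℓ := ℓ) (hbound.trans_lt hℓ1)
  have hsize : 2 * T + 4 + ℓ * (k + 1) ≤ n := by
    have h1 : (ℓ : ℝ) * (k + 1) ≤ n / 4 := by
      calc (ℓ : ℝ) * (k + 1) ≤ 2 * (2 ^ r * L ^ 2) * (k + 1) := by gcongr
        _ = 2 ^ r * (8 * (k + 1) * L ^ 2) / 4 := by ring
        _ ≤ (n : ℝ) ^ (1 / 2 : ℝ) * (n : ℝ) ^ (1 / 2 : ℝ) / 4 := by gcongr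
        _ = n / 4 := by rw [hhalf]
    have h2 : (2 * T + 4 + ℓ * (k + 1) : ℝ) ≤ n := by linarith
    exact_mod_cast h2
  refine ⟨T, ℓ, hTlow, hℓ2, hrL, hP T ℓ (n - (2 * T + 4 + ℓ * (k + 1))) n r
    (Fintype.equivFinOfCardEq ?_) ?_ M hM⟩
  · rw [GadgetVertex.card_eq]
    omega
  · have : (r : ℝ) < n := by linarith
    exact_mod_cast this

/-- The trade-off between the approximation ratio and the number of rounds. -/
theorem HasGapReductions.rounds_ge {P : ∀ n : ℕ, MinProblem n} {k : ℕ}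
    (hP : HasGapReductions P k) (b : ℕ) :
    ∃ c : ℝ, 0 < c ∧ ∃ N : ℕ, ∀ n : ℕ, N ≤ n → ∀ r : ℕ, (4 : ℝ) ^ r ≤ n → ∀ ρ : ℝ, 2 * ρ < r + 1 →
      ∀ (Ω : Type) [MeasurableSpace Ω] (μ : Measure Ω) [IsProbabilityMeasure μ]
        (A : Ω → Algorithm n (P n).Loc (P n).Out (b * Nat.clog 2 n)) (t : ℕ),
        (P n).IsApproxAlgorithm μ A ρ t → c * (n / (2 ^ r * Real.log n ^ 3)) ≤ (t : ℝ) := by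
  -- Here `41472 = 8 * 5184` and `5184 = 144 * 36`, with `36 = 3 * 6 * 2` from bandwidth, cut and
  -- `log 3`. The use of `b + 1` keeps the constant finite for `b = 0`.
  refine ⟨1 / (41472 * (b + 1)), by positivity, ?_⟩
  obtain ⟨N, hN⟩ := eventually_atTop.1
    ((eventually_const_mul_log_pow_le (8 * (k + 1)) 2 (s := 1 / 2) (by norm_num)).and
    ((eventually_const_mul_log_pow_le (3000 : ℝ) 1 (s := 1) (by norm_num)).and
    ((Real.tendsto_log_atTop.comp tendsto_natCast_atTop_atTop).eventually_ge_atTop (1 : ℝ))))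
  refine ⟨N, fun n hn r hr ρ hρ Ω _ μ _ A t hA => ?_⟩
  obtain ⟨h1, h2, h3⟩ := hN n hn
  simp only [Function.comp_apply, Real.rpow_one, pow_one] at h2 h3
  obtain ⟨T, ℓ, hT, hℓ, hrL, ⟨R⟩⟩ := hP.exists_gapReduction hr h3 h1 (by linarith)
  have hmain := R.card_le_of_isApproxAlgorithm μ A hρ hA
  set L := Real.log n with hL
  have hn0 : (0 : ℝ) < n := by linarith
  have hlogr : Real.log (r + 2) ≤ L := Real.log_le_log (by positivity) (by linarith)
  have hlog3 : Real.log 3 ≤ 2 := by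
    have := Real.log_le_sub_one_of_pos (show (0 : ℝ) < 3 by norm_num)
    linarith
  have hlog3' : 0 ≤ Real.log 3 := Real.log_nonneg (by norm_num)
  have hpow : (1 : ℝ) ≤ 2 ^ r := one_le_pow₀ (by norm_num)
  have hD : (1 : ℝ) ≤ 2 ^ r * L ^ 2 := one_le_mul_of_one_le_of_one_le hpow (one_le_pow₀ h3)
  have hcut : ((2 * (ℓ + 1) : ℕ) : ℝ) ≤ 6 * (2 ^ r * L ^ 2) := by
    push_cast
    linarith
  have hB : ((b * Nat.clog 2 n : ℕ) : ℝ) ≤ (b + 1) * (3 * L) := by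
    push_cast
    exact mul_le_mul (by linarith) (clog_two_le h3) (Nat.cast_nonneg _) (by positivity)
  have hprod : ((b * Nat.clog 2 n : ℕ) : ℝ) * t * ((2 * (ℓ + 1) : ℕ) : ℝ) * Real.log 3 ≤
      (b + 1) * (3 * L) * t * (6 * (2 ^ r * L ^ 2)) * 2 := by gcongr
  -- The lower-order terms `1 + 288 * L` are absorbed in `n / 8`, since `n ≥ 3000 * L`.
  have hfin : (n : ℝ) / 8 ≤ 5184 * ((b + 1) * t * (2 ^ r * L ^ 3)) := by
    have : (b + 1) * (3 * L) * t * (6 * (2 ^ r * L ^ 2)) * 2 =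
      36 * ((b + 1) * t * (2 ^ r * L ^ 3)) := by ring
    linarith
  rw [div_mul_div_comm, one_mul, div_le_iff₀ (by positivity)]
  linarith

theorem HasGapReductions.requiresRounds_log {P : ∀ n : ℕ, MinProblem n} {k : ℕ}
    (hP : HasGapReductions P k) :
    ∃ β : ℝ, 0 < β ∧ ∀ ε : ℝ, 0 < ε → ε < 1 →
      RequiresRounds P (fun n => β * ε * Real.log n)
        (fun n => (n : ℝ) ^ (1 - ε) / Real.log n) := by
  refine ⟨1 / 4, by norm_num, fun ε hε hε1 b => ?_⟩
  obtain ⟨c, hc, N, hN⟩ := hP.rounds_ge b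
  obtain ⟨N', hN'⟩ := eventually_atTop.1
    ((eventually_const_mul_log_pow_le 1 2 (s := ε / 2) (by positivity)).and
    ((Real.tendsto_log_atTop.comp tendsto_natCast_atTop_atTop).eventually_ge_atTop (1 : ℝ)))
  refine ⟨c, hc, max N N', fun n hn Ω _ μ _ A t hA => ?_⟩
  obtain ⟨h1, h2⟩ := hN' n (le_of_max_le_right hn)
  simp only [Function.comp_apply, one_mul] at h1 h2
  set L := Real.log n with hL
  have hn0 : (0 : ℝ) < n := by
    rcases Nat.eq_zero_or_pos n with h0 | h0
    · rw [hL, h0] at h2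
      norm_num at h2
    · exact_mod_cast h0
  have hexp : ∀ a : ℝ, Real.exp (L * a) = (n : ℝ) ^ a := fun a =>
    (Real.rpow_def_of_pos hn0 a).symm
  -- Then `2 * ρ = ε * L / 2 < r + 1`, while `2 ^ r` and `L ^ 2` are each at most `n ^ (ε / 2)`.
  set r := ⌊ε * L / 2⌋₊ with hr
  have hr1 : (r : ℝ) ≤ ε * L / 2 := Nat.floor_le (by positivity)
  have hr2 : ε * L / 2 < r + 1 := Nat.lt_floor_add_one _
  have h2r : (2 : ℝ) ^ r ≤ (n : ℝ) ^ (ε / 2) := by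
    refine (two_pow_le_exp r).trans ?_
    rw [← hexp]
    exact Real.exp_le_exp.2 (by linarith)
  have h4r : (4 : ℝ) ^ r ≤ n := by
    calc (4 : ℝ) ^ r = 2 ^ r * 2 ^ r := by rw [← mul_pow]; norm_num
      _ ≤ (n : ℝ) ^ (ε / 2) * (n : ℝ) ^ (ε / 2) := by gcongr
      _ = (n : ℝ) ^ ε := by rw [← Real.rpow_add hn0, add_halves]
      _ ≤ (n : ℝ) ^ (1 : ℝ) := by
        rw [← hexp, ← hexp]
        exact Real.exp_le_exp.2 (by nlinarith)
      _ = n := Real.rpow_one _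
  refine le_trans ?_ (hN n (le_of_max_le_left hn) r h4r (1 / 4 * ε * L) (by linarith) Ω μ A t hA)
  refine mul_le_mul_of_nonneg_left ?_ hc.le
  rw [div_le_div_iff₀ (by linarith) (by positivity)]
  have h3 : (n : ℝ) ^ (1 - ε) * (2 ^ r * L ^ 2) ≤ n := by
    calc (n : ℝ) ^ (1 - ε) * (2 ^ r * L ^ 2) ≤
        (n : ℝ) ^ (1 - ε) * ((n : ℝ) ^ (ε / 2) * (n : ℝ) ^ (ε / 2)) := by gcongr
      _ = n := by
        rw [← Real.rpow_add hn0, ← Real.rpow_add hn0, add_halves, sub_add_cancel, Real.rpow_one]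
  calc (n : ℝ) ^ (1 - ε) * (2 ^ r * L ^ 3) = (n : ℝ) ^ (1 - ε) * (2 ^ r * L ^ 2) * L := by ring
    _ ≤ n * L := mul_le_mul_of_nonneg_right h3 (by linarith)

theorem HasGapReductions.requiresRounds_log_log {P : ∀ n : ℕ, MinProblem n} {k : ℕ}
    (hP : HasGapReductions P k) :
    ∃ β : ℝ, 0 < β ∧ ∃ p : ℕ,
      RequiresRounds P (fun n => β * Real.log (Real.log n))
        (fun n => (n : ℝ) / Real.log n ^ p) := by
  refine ⟨1 / 4, by norm_num, 4, fun b => ?_⟩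
  obtain ⟨c, hc, N, hN⟩ := hP.rounds_ge b
  obtain ⟨N', hN'⟩ := eventually_atTop.1
    ((eventually_const_mul_log_pow_le 1 2 (s := 1) (by positivity)).and
    ((Real.tendsto_log_atTop.comp tendsto_natCast_atTop_atTop).eventually_ge_atTop (1 : ℝ)))
  refine ⟨c, hc, max N N', fun n hn Ω _ μ _ A t hA => ?_⟩
  obtain ⟨h1, h2⟩ := hN' n (le_of_max_le_right hn)
  simp only [Function.comp_apply, one_mul, Real.rpow_one] at h1 h2
  set L := Real.log n with hL
  have hlogL : 0 ≤ Real.log L := Real.log_nonneg h2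
  -- Now `2 ^ r ≤ L`, which costs one more logarithm: the exponent is `3 + 1 = 4`.
  set r := ⌊Real.log L⌋₊ with hr
  have hr1 : (r : ℝ) ≤ Real.log L := Nat.floor_le hlogL
  have hr2 : Real.log L < r + 1 := Nat.lt_floor_add_one _
  have h2r : (2 : ℝ) ^ r ≤ L := by
    refine (two_pow_le_exp r).trans ?_
    calc Real.exp r ≤ Real.exp (Real.log L) := Real.exp_le_exp.2 hr1
      _ = L := Real.exp_log (by linarith)
  have h4r : (4 : ℝ) ^ r ≤ n := by
    calc (4 : ℝ) ^ r = 2 ^ r * 2 ^ r := by rw [← mul_pow]; norm_num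
      _ ≤ L * L := by gcongr
      _ = L ^ 2 := by ring
      _ ≤ n := h1
  refine le_trans ?_
    (hN n (le_of_max_le_left hn) r h4r (1 / 4 * Real.log L) (by linarith) Ω μ A t hA)
  refine mul_le_mul_of_nonneg_left (div_le_div_of_nonneg_left (Nat.cast_nonneg n) (by positivity) ?_)
    hc.le
  calc (2 : ℝ) ^ r * L ^ 3 ≤ L * L ^ 3 := by gcongr
    _ = L ^ 4 := by ring

theorem hasGapReductions_kMDS {k : ℕ} (hk : 2 ≤ k) : HasGapReductions (kMDS k) k :=
  fun _ _ _ _ _ e hrn M hM => ⟨GadgetVertex.kMDSReduction e hk hrn M hM⟩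

theorem hasGapReductions_nodeSteiner : HasGapReductions nodeSteiner 2 :=
  fun _ _ _ _ _ e hrn M hM => ⟨GadgetVertex.nodeSteinerReduction e hrn M hM⟩

theorem hasGapReductions_directedSteiner : HasGapReductions directedSteiner 2 :=
  fun _ _ _ _ _ e hrn M hM => ⟨GadgetVertex.directedSteinerReduction e hrn M hM⟩

end Congest
theorem mainTheorem10 :
    -- weighted `k`-MDS, for every constant `k ≥ 2`
    (∀ k : ℕ, 2 ≤ k →
      (∃ β : ℝ, 0 < β ∧ ∀ ε : ℝ, 0 < ε → ε < 1 →
        Congest.RequiresRounds (Congest.kMDS k)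
          (fun n => β * ε * Real.log n) (fun n => (n : ℝ) ^ (1 - ε) / Real.log n)) ∧
      (∃ β : ℝ, 0 < β ∧ ∃ p : ℕ,
        Congest.RequiresRounds (Congest.kMDS k)
          (fun n => β * Real.log (Real.log n)) (fun n => (n : ℝ) / Real.log n ^ p))) ∧
    -- node weighted Steiner tree
    ((∃ β : ℝ, 0 < β ∧ ∀ ε : ℝ, 0 < ε → ε < 1 →
        Congest.RequiresRounds Congest.nodeSteiner
          (fun n => β * ε * Real.log n) (fun n => (n : ℝ) ^ (1 - ε) / Real.log n)) ∧
      (∃ β : ℝ, 0 < β ∧ ∃ p : ℕ,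
        Congest.RequiresRounds Congest.nodeSteiner
          (fun n => β * Real.log (Real.log n)) (fun n => (n : ℝ) / Real.log n ^ p))) ∧
    -- directed Steiner tree
    ((∃ β : ℝ, 0 < β ∧ ∀ ε : ℝ, 0 < ε → ε < 1 →
        Congest.RequiresRounds Congest.directedSteiner
          (fun n => β * ε * Real.log n) (fun n => (n : ℝ) ^ (1 - ε) / Real.log n)) ∧
      (∃ β : ℝ, 0 < β ∧ ∃ p : ℕ,
        Congest.RequiresRounds Congest.directedSteiner
          (fun n => β * Real.log (Real.log n)) (fun n => (n : ℝ) / Real.log n ^ p))) := by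
  exact ⟨fun k hk => ⟨(Congest.hasGapReductions_kMDS hk).requiresRounds_log,
      (Congest.hasGapReductions_kMDS hk).requiresRounds_log_log⟩,
    ⟨Congest.hasGapReductions_nodeSteiner.requiresRounds_log,
      Congest.hasGapReductions_nodeSteiner.requiresRounds_log_log⟩,
    ⟨Congest.hasGapReductions_directedSteiner.requiresRounds_log,
      Congest.hasGapReductions_directedSteiner.requiresRounds_log_log⟩⟩
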